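/- **Setting.** Modal formulas are in negation normal form, $A ::= P \mid \neg P \mid A\vee A \mid A\wedge A \mid \Box A \mid \Diamond A$. Write $\overline A$ for the negation normal form of the negation of $A$. Consider four proof systems for the modal logic K. * **LS** (one-sided G3K). Sequents $\mathcal G\vdash\Delta$, with $\mathcal G$ a finite set of relational atoms $xRy$ and $\Delta$ a multiset of labeled formulas $x:A$. Axioms $\mathcal G\vdash\Delta,x:\neg P,x:P$. The rules, read from conclusion to premises, are: $\Delta,x:A\wedge B$ to $\Delta,x:A$ and $\Delta,x:B$; $\Delta,x:A\vee B$ to $\Delta,x:A,x:B$; $\mathcal G\vdash\Delta,x:\Box A$ to $\mathcal G\cup\{xRy\}\vdash\Delta,y:A$, with $y$ not in the conclusion; $\Delta,x:\Diamond A$ to $\Delta,x:\Diamond A,y:A$, if $xRy\in\mathcal G$. A proof of $A$ is a proof of $\vdash x:A$ for a variable $x$; $A$ is provable if this is derivable for every $x$. * **PT** (prefixed tableaux). Prefixes are finite sequences of positive integers. A proof of $A$ is a closed tableau with root $1:\overline A$. Branches are extended by: $\sigma:A$ and $\sigma:B$, if $\sigma:A\wedge B$ is on the branch; splitting into $\sigma:A\mid\sigma:B$,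 for $\sigma:A\vee B$; $\sigma.n:A$, for $\sigma:\Box A$ with $\sigma.n$ on the branch; $\sigma.n:A$, for $\sigma:\Diamond A$ with $\sigma.n$ not on the branch. A branch is closed if it contains $\sigma:P$ and $\sigma:\neg P$. * **OS** (ordinary sequents). Multisets of formulas. Axioms $\vdash\Gamma,P,\neg P$; the usual rules for $\wedge$ and $\vee$; and from $\vdash\Gamma,A$ infer $\vdash\Diamond\Gamma,\Box A,\Delta$. A proof of $A$ is a proof of $\vdash A$. * **NS** (Brünnler's nested sequents). Axioms $\Gamma\{P,\neg P\}$; from $\Gamma\{A\}$ and $\Gamma\{B\}$ infer $\Gamma\{A\wedge B\}$; from $\Gamma\{A,B\}$ infer $\Gamma\{A\vee B\}$; from $\Gamma\{[A]\}$ infer $\Gamma\{\Box A\}$; from $\Gamma\{\Diamond A,[A,\mathcal M]\}$ infer $\Gamma\{\Diamond A,[\mathcal M]\}$. A proof of $A$ is a proof of the nested sequent $A$. Let LKF be the focused sequent calculus (with cut) for classical first-order logic, over the language with a binary predicate $R$ and a unary predicate for each $P$, where all atoms are positive; its sequents are $\vdash\Theta\Uparrow\Gamma$ and $\vdash\Theta\Downarrow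 B$. A *bipole* is a derivation from sequents $\vdash\Theta_i\Uparrow\cdot$ to a sequent $\vdash\Theta\Uparrow\cdot$ that consists of a decide, a synchronous phase and asynchronous phases above it. Put $\partial^+(F)=\mathit{true}\wedge^+F$ and $\partial^-(F)=\mathit{false}\vee^-F$, and let $F^{\partial}$ be $F$ if $F$ is a literal or positive, and $\partial^+(F)$ otherwise. The polarized standard translation is $$[P]_x=P(x),\quad[\neg P]_x=\neg P(x),\quad[A\wedge B]_x=[A]_x^{\partial}\wedge^-[B]_x^{\partial},\quad[A\vee B]_x=[A]_x^{\partial}\vee^-[B]_x^{\partial},$$ $$[\Box A]_x=\forall y\,(\neg R(x,y)\vee^-[A]_y^{\partial}),\qquad[\Diamond A]_x=\exists y\,(R(x,y)\wedge^+\partial^-([A]_y^{\partial})).$$ **Theorem.** Let $X\in\{\mathrm{LS},\mathrm{PT},\mathrm{OS},\mathrm{NS}\}$, let $A$ be a modal formula and $x$ a variable. 1. $A$ has a proof in $X$ if and only if $[A]_x$ has a proof in LKF, i.e. a proof of $\vdash\cdot\Uparrow[A]_x$; and if and only if LKF proves $\vdash[A]_x^{\partial}\Uparrow\cdot$, the sequent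 in which the (delayed) formula is already stored. 2. For every proof $\Pi$ of $A$ in $X$ (of $\vdash x:A$ if $X$ is LS) there is an LKF proof $\Pi'$ of $\vdash[A]_x^{\partial}\Uparrow\cdot$ such that each application of a rule $r$ in $\Pi$ corresponds to a non-empty sequence of bipoles in $\Pi'$, the premises of $r$ corresponding, in order, to the premises of the sequence. Here a formula $B$ at a world that is represented by the variable $z$ corresponds to $[B]_z^{\partial}$ (for PT: to $[\overline B]_z^{\partial}$), and that $v$ is a successor of $u$ corresponds to $\neg R(u,v)$. The bipoles decide on the translations of the principal formulas of $r$ (for an axiom or a branch closure: on the positive literal; for the modal rule of OS: first on that of $\Box A$, then one after the other on those of the formulas in $\Diamond\Gamma$). Each premise of the sequence is obtained from its conclusion $\vdash\Theta\Uparrow\cdot$ by adding to $\Theta$ exactly the translations of the formulas that $r$ introduces in the corresponding premise, together with $\neg R(u,v)$ if $r$ introduces a new world $v$, a successor of $u$. -/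

import Mathlib

/-! # Four proof systems for the modal logic K and the focused first-order calculus LKF -/

namespace ModalCert

universe u

/-! ## Modal formulas in negation normal form -/

/-- Modal formulas in negation normal form over a set `α` of propositional symbols. -/
inductive Modal (α : Type u) : Type u
  | atom (p : α)
  | natom (p : α)
  | or (A B : Modal α)
  | and (A B : Modal α)
  | box (A : Modal α)
  | dia (A : Modal α)

/-- The negation normal form of the negation of a formula. -/
def Modal.neg {α : Type u} : Modal α → Modal α
  | .atom p => .natom p
  | .natom p => .atom p
  | .or A B => .and A.neg B.neg
  | .and A B => .or A.neg B.neg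
  | .box A => .dia A.neg
  | .dia A => .box A.neg

/-! ## The labeled sequent calculus LS (a one-sided G3K)

Labels are variables, represented by natural numbers. A sequent `G ⊢ Δ` consists of a finite set `G`
of relational atoms (`(x, y)` stands for `x R y`) and a multiset `Δ` of labeled formulas. -/

/-- Derivations in the labeled sequent calculus. -/
inductive LS {α : Type u} : Finset (ℕ × ℕ) → Multiset (ℕ × Modal α) → Type u
  | init {G : Finset (ℕ × ℕ)} (Δ : Multiset (ℕ × Modal α)) (x : ℕ) (p : α) :
      LS G ((x, .natom p) ::ₘ (x, .atom p) ::ₘ Δ)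
  | and {G : Finset (ℕ × ℕ)} {Δ : Multiset (ℕ × Modal α)} (x : ℕ) (A B : Modal α) :
      LS G ((x, A) ::ₘ Δ) → LS G ((x, B) ::ₘ Δ) → LS G ((x, .and A B) ::ₘ Δ)
  | or {G : Finset (ℕ × ℕ)} {Δ : Multiset (ℕ × Modal α)} (x : ℕ) (A B : Modal α) :
      LS G ((x, A) ::ₘ (x, B) ::ₘ Δ) → LS G ((x, .or A B) ::ₘ Δ)
  | box {G : Finset (ℕ × ℕ)} {Δ : Multiset (ℕ × Modal α)} (x y : ℕ) (A : Modal α)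
      (fresh_x : y ≠ x) (fresh_G : ∀ e ∈ G, y ≠ e.1 ∧ y ≠ e.2) (fresh_Δ : ∀ φ ∈ Δ, y ≠ φ.1) :
      LS (insert (x, y) G) ((y, A) ::ₘ Δ) → LS G ((x, .box A) ::ₘ Δ)
  | dia {G : Finset (ℕ × ℕ)} {Δ : Multiset (ℕ × Modal α)} (x y : ℕ) (A : Modal α)
      (rel : (x, y) ∈ G) :
      LS G ((x, .dia A) ::ₘ (y, A) ::ₘ Δ) → LS G ((x, .dia A) ::ₘ Δ)

/-! ## Prefixed tableaux PT

A branch is the list of the prefixed formulas on it; `PT b` is the type of closed tableaux extending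
the branch `b`. -/

/-- Prefixes: finite sequences of positive integers; `σ.n` is `σ ++ [n]`. -/
abbrev Prefix : Type := List ℕ+

/-- Closed prefixed tableaux extending a given branch. -/
inductive PT {α : Type u} : List (Prefix × Modal α) → Type u
  | close {b : List (Prefix × Modal α)} (σ : Prefix) (p : α)
      (pos : (σ, .atom p) ∈ b) (neg : (σ, .natom p) ∈ b) : PT b
  | and {b : List (Prefix × Modal α)} (σ : Prefix) (A B : Modal α)
      (mem : (σ, .and A B) ∈ b) : PT ((σ, A) :: (σ, B) :: b) → PT b
  | or {b : List (Prefix × Modal α)} (σ : Prefix) (A B : Modal α)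
      (mem : (σ, .or A B) ∈ b) : PT ((σ, A) :: b) → PT ((σ, B) :: b) → PT b
  | box {b : List (Prefix × Modal α)} (σ : Prefix) (n : ℕ+) (A : Modal α)
      (mem : (σ, .box A) ∈ b) (used : ∃ φ ∈ b, φ.1 = σ ++ [n]) : PT ((σ ++ [n], A) :: b) → PT b
  | dia {b : List (Prefix × Modal α)} (σ : Prefix) (n : ℕ+) (A : Modal α)
      (mem : (σ, .dia A) ∈ b) (new : ∀ φ ∈ b, φ.1 ≠ σ ++ [n]) : PT ((σ ++ [n], A) :: b) → PT b

/-! ## The ordinary sequent calculus OS -/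

/-- Derivations in the ordinary sequent calculus. -/
inductive OS {α : Type u} : Multiset (Modal α) → Type u
  | init (Γ : Multiset (Modal α)) (p : α) : OS (.atom p ::ₘ .natom p ::ₘ Γ)
  | and {Γ : Multiset (Modal α)} (A B : Modal α) :
      OS (A ::ₘ Γ) → OS (B ::ₘ Γ) → OS (.and A B ::ₘ Γ)
  | or {Γ : Multiset (Modal α)} (A B : Modal α) : OS (A ::ₘ B ::ₘ Γ) → OS (.or A B ::ₘ Γ)
  | box (Γ Δ : Multiset (Modal α)) (A : Modal α) :
      OS (A ::ₘ Γ) → OS (Γ.map Modal.dia + .box A ::ₘ Δ)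

/-! ## The nested sequent calculus NS

A nested sequent is a multiset of formulas together with finitely many boxed sequents. The latter are
kept in a list, so that the nodes of the tree can be addressed by paths; the rules can be applied at
every node and to every boxed sequent, whatever its place in the list. -/

/-- Nested sequents. -/
inductive Nested (α : Type u) : Type u
  | node (fs : Multiset (Modal α)) (bs : List (Nested α)) : Nested α

/-- The nested sequent `A, M`. -/
def Nested.insert {α : Type u} (A : Modal α) : Nested α → Nested α
  | .node fs bs => .node (A ::ₘ fs) bs

/-- The nested sequent that consists of the single formula `A`. -/
def Nested.single {α : Type u} (A : Modal α) : Nested α := .node {A} []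

/-- Contexts: nested sequents with one hole, at the root (`here`) or inside a boxed sequent (`under`). -/
inductive Context (α : Type u) : Type u
  | here (fs : Multiset (Modal α)) (bs : List (Nested α)) : Context α
  | under (fs : Multiset (Modal α)) (left : List (Nested α)) (C : Context α)
      (right : List (Nested α)) : Context α

/-- `C.fill M` is the context `C` with `M` put in place of the hole. -/
def Context.fill {α : Type u} : Context α → Nested α → Nested α
  | .here fs bs, .node gs cs => .node (fs + gs) (bs ++ cs)
  | .under fs left C right, M => .node fs (left ++ C.fill M :: right)

/-- The path from the root to the node that contains the hole. -/
def Context.path {α : Type u} : Context α → List ℕ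
  | .here _ _ => []
  | .under _ left C _ => left.length :: C.path

/-- The number of boxed sequents that the context has at the node that contains the hole. -/
def Context.width {α : Type u} : Context α → ℕ
  | .here _ bs => bs.length
  | .under _ _ C _ => C.width

/-- Derivations in the nested sequent calculus. In `dia`, the list `N` holds the boxed sequents that
stand behind the active one, so that the active one can be any boxed sequent of the node. -/
inductive NS {α : Type u} : Nested α → Type u
  | init (C : Context α) (p : α) : NS (C.fill (.node {.atom p, .natom p} []))
  | and (C : Context α) (A B : Modal α) :
      NS (C.fill (.single A)) → NS (C.fill (.single B)) → NS (C.fill (.single (.and A B)))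
  | or (C : Context α) (A B : Modal α) :
      NS (C.fill (.node {A, B} [])) → NS (C.fill (.single (.or A B)))
  | box (C : Context α) (A : Modal α) :
      NS (C.fill (.node 0 [.single A])) → NS (C.fill (.single (.box A)))
  | dia (C : Context α) (A : Modal α) (M : Nested α) (N : List (Nested α)) :
      NS (C.fill (.node {.dia A} (M.insert A :: N))) → NS (C.fill (.node {.dia A} (M :: N)))

/-! ## Polarized formulas of the first-order correspondence language

The language has a binary predicate symbol `R` and a unary one for each propositional symbol; its
terms are variables. Free variables are natural numbers. A formula in `Form α n` has, in addition,
`n` variables that are to be bound from outside, numbered from the outermost binder inwards. All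
atoms are positive. -/

/-- Terms: free variables, and variables bound from outside. -/
abbrev Term (n : ℕ) : Type := ℕ ⊕ Fin n

/-- Polarized first-order formulas in negation normal form. -/
inductive Form (α : Type u) : ℕ → Type u
  | atom {n : ℕ} (p : α) (t : Term n) : Form α n
  | natom {n : ℕ} (p : α) (t : Term n) : Form α n
  | rel {n : ℕ} (s t : Term n) : Form α n
  | nrel {n : ℕ} (s t : Term n) : Form α n
  | truePos {n : ℕ} : Form α n
  | trueNeg {n : ℕ} : Form α n
  | falsePos {n : ℕ} : Form α n
  | falseNeg {n : ℕ} : Form α n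
  | andPos {n : ℕ} (A B : Form α n) : Form α n
  | andNeg {n : ℕ} (A B : Form α n) : Form α n
  | orPos {n : ℕ} (A B : Form α n) : Form α n
  | orNeg {n : ℕ} (A B : Form α n) : Form α n
  | all {n : ℕ} (B : Form α (n + 1)) : Form α n
  | ex {n : ℕ} (B : Form α (n + 1)) : Form α n

/-- Put the free variable `y` in place of the outermost bound variable. -/
def Term.inst {n : ℕ} (y : ℕ) : Term (n + 1) → Term n
  | .inl z => .inl z
  | .inr i => Fin.cases (.inl y) .inr i

namespace Form

/-- `[y/x]B`, where `x` is the outermost variable of `B` that is bound from outside. -/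
def inst {α : Type u} (y : ℕ) : {n : ℕ} → Form α (n + 1) → Form α n
  | _, .atom p t => .atom p (t.inst y)
  | _, .natom p t => .natom p (t.inst y)
  | _, .rel s t => .rel (s.inst y) (t.inst y)
  | _, .nrel s t => .nrel (s.inst y) (t.inst y)
  | _, .truePos => .truePos
  | _, .trueNeg => .trueNeg
  | _, .falsePos => .falsePos
  | _, .falseNeg => .falseNeg
  | _, .andPos A B => .andPos (A.inst y) (B.inst y)
  | _, .andNeg A B => .andNeg (A.inst y) (B.inst y)
  | _, .orPos A B => .orPos (A.inst y) (B.inst y)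
  | _, .orNeg A B => .orNeg (A.inst y) (B.inst y)
  | _, .all B => .all (B.inst y)
  | _, .ex B => .ex (B.inst y)

/-- The variable `y` is free in the formula. -/
def Free {α : Type u} (y : ℕ) : {n : ℕ} → Form α n → Prop
  | _, .atom _ t => t = .inl y
  | _, .natom _ t => t = .inl y
  | _, .rel s t => s = .inl y ∨ t = .inl y
  | _, .nrel s t => s = .inl y ∨ t = .inl y
  | _, .truePos => False
  | _, .trueNeg => False
  | _, .falsePos => False
  | _, .falseNeg => False
  | _, .andPos A B => A.Free y ∨ B.Free y
  | _, .andNeg A B => A.Free y ∨ B.Free y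
  | _, .orPos A B => A.Free y ∨ B.Free y
  | _, .orNeg A B => A.Free y ∨ B.Free y
  | _, .all B => B.Free y
  | _, .ex B => B.Free y

/-- The negation normal form of the negation of a formula. -/
def neg {α : Type u} : {n : ℕ} → Form α n → Form α n
  | _, .atom p t => .natom p t
  | _, .natom p t => .atom p t
  | _, .rel s t => .nrel s t
  | _, .nrel s t => .rel s t
  | _, .truePos => .falseNeg
  | _, .trueNeg => .falsePos
  | _, .falsePos => .trueNeg
  | _, .falseNeg => .truePos
  | _, .andPos A B => .orNeg A.neg B.neg
  | _, .andNeg A B => .orPos A.neg B.neg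
  | _, .orPos A B => .andNeg A.neg B.neg
  | _, .orNeg A B => .andPos A.neg B.neg
  | _, .all B => .ex B.neg
  | _, .ex B => .all B.neg

/-- Positive formulas. The formulas that are not positive are the negative ones. -/
def Pos {α : Type u} : {n : ℕ} → Form α n → Prop
  | _, .atom _ _ => True
  | _, .rel _ _ => True
  | _, .truePos => True
  | _, .falsePos => True
  | _, .andPos _ _ => True
  | _, .orPos _ _ => True
  | _, .ex _ => True
  | _, _ => False

/-- Positive literals, i.e. atoms. -/
def PosLit {α : Type u} : {n : ℕ} → Form α n → Prop
  | _, .atom _ _ => True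
  | _, .rel _ _ => True
  | _, _ => False

/-- Negative literals, i.e. negated atoms. -/
def NegLit {α : Type u} : {n : ℕ} → Form α n → Prop
  | _, .natom _ _ => True
  | _, .nrel _ _ => True
  | _, _ => False

/-- The delay `∂⁺(A) = true ∧⁺ A`. -/
def delayPos {α : Type u} {n : ℕ} (A : Form α n) : Form α n := .andPos .truePos A

/-- The delay `∂⁻(A) = false ∨⁻ A`. -/
def delayNeg {α : Type u} {n : ℕ} (A : Form α n) : Form α n := .orNeg .falseNeg A

open Classical in
/-- `A` itself if `A` is a literal or a positive formula, and `∂⁺(A)` otherwise. -/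
noncomputable def delay {α : Type u} {n : ℕ} (A : Form α n) : Form α n :=
  if A.Pos ∨ A.NegLit then A else A.delayPos

end Form

/-- The polarized standard translation `[A]_t`. In the clauses for the modalities, `.inr (Fin.last n)`
is the variable bound by the new quantifier. -/
noncomputable def trans {α : Type u} : {n : ℕ} → Modal α → Term n → Form α n
  | _, .atom p, t => .atom p t
  | _, .natom p, t => .natom p t
  | _, .and A B, t => .andNeg (trans A t).delay (trans B t).delay
  | _, .or A B, t => .orNeg (trans A t).delay (trans B t).delay
  | n, .box A, t =>
      .all (.orNeg (.nrel (t.map id Fin.castSucc) (.inr (Fin.last n)))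
        (trans A (.inr (Fin.last n))).delay)
  | n, .dia A, t =>
      .ex (.andPos (.rel (t.map id Fin.castSucc) (.inr (Fin.last n)))
        (trans A (.inr (Fin.last n))).delay.delayNeg)

/-- `[A]_x` for a variable `x`. -/
noncomputable def tr {α : Type u} (A : Modal α) (x : ℕ) : Form α 0 := trans A (.inl x)

/-- `[A]_x`, with a positive delay in front if it is negative and not a literal. -/
noncomputable def dtr {α : Type u} (A : Modal α) (x : ℕ) : Form α 0 := (tr A x).delay

/-- The negative literal `¬R(x, y)`. -/
def notR {α : Type u} (x y : ℕ) : Form α 0 := .nrel (.inl x) (.inl y)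

/-! ## The focused sequent calculus LKF -/

/-- Sequents of LKF: `async Θ Γ` is `⊢ Θ ⇑ Γ`, and `sync Θ B` is `⊢ Θ ⇓ B`. -/
inductive Sequent (α : Type u) : Type u
  | async (Θ Γ : Multiset (Form α 0)) : Sequent α
  | sync (Θ : Multiset (Form α 0)) (B : Form α 0) : Sequent α

open Sequent in
/-- Proofs in LKF. -/
inductive LKF {α : Type u} : Sequent α → Type u
  | andNeg {Θ Γ : Multiset (Form α 0)} (A B : Form α 0) :
      LKF (async Θ (A ::ₘ Γ)) → LKF (async Θ (B ::ₘ Γ)) → LKF (async Θ (.andNeg A B ::ₘ Γ))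
  | orNeg {Θ Γ : Multiset (Form α 0)} (A B : Form α 0) :
      LKF (async Θ (A ::ₘ B ::ₘ Γ)) → LKF (async Θ (.orNeg A B ::ₘ Γ))
  | all {Θ Γ : Multiset (Form α 0)} (B : Form α 1) (y : ℕ)
      (fresh_Θ : ∀ F ∈ Θ, ¬ F.Free y) (fresh_Γ : ∀ F ∈ Γ, ¬ F.Free y) (fresh_B : ¬ B.Free y) :
      LKF (async Θ (B.inst y ::ₘ Γ)) → LKF (async Θ (.all B ::ₘ Γ))
  | trueNeg {Θ Γ : Multiset (Form α 0)} : LKF (async Θ (.trueNeg ::ₘ Γ))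
  | falseNeg {Θ Γ : Multiset (Form α 0)} : LKF (async Θ Γ) → LKF (async Θ (.falseNeg ::ₘ Γ))
  | truePos {Θ : Multiset (Form α 0)} : LKF (sync Θ .truePos)
  | andPos {Θ : Multiset (Form α 0)} (A B : Form α 0) :
      LKF (sync Θ A) → LKF (sync Θ B) → LKF (sync Θ (.andPos A B))
  | orPosLeft {Θ : Multiset (Form α 0)} (A B : Form α 0) :
      LKF (sync Θ A) → LKF (sync Θ (.orPos A B))
  | orPosRight {Θ : Multiset (Form α 0)} (A B : Form α 0) :
      LKF (sync Θ B) → LKF (sync Θ (.orPos A B))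
  | ex {Θ : Multiset (Form α 0)} (B : Form α 1) (t : ℕ) :
      LKF (sync Θ (B.inst t)) → LKF (sync Θ (.ex B))
  | cut {Θ : Multiset (Form α 0)} (B : Form α 0) :
      LKF (async Θ {B}) → LKF (async Θ {B.neg}) → LKF (async Θ 0)
  | init {Θ : Multiset (Form α 0)} (P : Form α 0) (lit : P.PosLit) (mem : P.neg ∈ Θ) :
      LKF (sync Θ P)
  | release {Θ : Multiset (Form α 0)} (N : Form α 0) (neg : ¬ N.Pos) :
      LKF (async Θ {N}) → LKF (sync Θ N)
  | store {Θ Γ : Multiset (Form α 0)} (C : Form α 0) (pos : C.Pos ∨ C.NegLit) :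
      LKF (async (C ::ₘ Θ) Γ) → LKF (async Θ (C ::ₘ Γ))
  | decide {Θ : Multiset (Form α 0)} (P : Form α 0) (pos : P.Pos) (mem : P ∈ Θ) :
      LKF (sync Θ P) → LKF (async Θ 0)

/-! ## Bipoles -/

/-- A proof together with its end-sequent. -/
abbrev SomeLKF (α : Type u) : Type u := Σ S : Sequent α, LKF S

/-- The subproofs that are reached from the root of a proof by following the current phases up to
the sequents `⊢ Θ ⇑ ·`, where a `decide` or a `cut` begins. -/
def LKF.frontier {α : Type u} : {S : Sequent α} → LKF S → List (SomeLKF α)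
  | _, .andNeg _ _ d e => d.frontier ++ e.frontier
  | _, .orNeg _ _ d => d.frontier
  | _, .all _ _ _ _ _ d => d.frontier
  | _, .trueNeg => []
  | _, .falseNeg d => d.frontier
  | _, .truePos => []
  | _, .andPos _ _ d e => d.frontier ++ e.frontier
  | _, .orPosLeft _ _ d => d.frontier
  | _, .orPosRight _ _ d => d.frontier
  | _, .ex _ _ d => d.frontier
  | _, .cut B d e => [⟨_, .cut B d e⟩]
  | _, .init _ _ _ => []
  | _, .release _ _ d => d.frontier
  | _, .store _ _ d => d.frontier
  | _, .decide P h m d => [⟨_, .decide P h m d⟩]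

/-- `Bipole d F L`: the proof `d` ends in a bipole, i.e. in a `decide` on the formula `F` followed
(upwards) by a synchronous phase and by asynchronous phases up to sequents `⊢ Θ ⇑ ·`, and `L` lists
the subproofs of the premises of this bipole. -/
inductive Bipole {α : Type u} : {S : Sequent α} → LKF S → Form α 0 → List (SomeLKF α) → Prop
  | mk {Θ : Multiset (Form α 0)} (P : Form α 0) (pos : P.Pos) (mem : P ∈ Θ)
      (d : LKF (.sync Θ P)) : Bipole (.decide P pos mem d) P d.frontier

/-- `Bipoles d Fs L`: the proof `d` ends in a (non-empty) sequence of bipoles that decide, from the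
root upwards, on the formulas `Fs`. Each bipole but the last one has exactly one premise, which is
the conclusion of the next one, and `L` lists the subproofs of the premises of the last one. -/
inductive Bipoles {α : Type u} :
    {S : Sequent α} → LKF S → List (Form α 0) → List (SomeLKF α) → Prop
  | last {S : Sequent α} {d : LKF S} {F : Form α 0} {L : List (SomeLKF α)} :
      Bipole d F L → Bipoles d [F] L
  | step {S T : Sequent α} {d : LKF S} {e : LKF T} {F : Form α 0} {Fs : List (Form α 0)}
      {L : List (SomeLKF α)} :
      Bipole d F [⟨T, e⟩] → Bipoles e Fs L → Bipoles d (F :: Fs) L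

/-! ## Correspondence of proofs

A proof `d` in LKF emulates a proof `q` in one of the four systems if the last rule of `q` corresponds
to a sequence of bipoles at the root of `d`, and the proofs of the premises of this rule are, in order,
emulated by the proofs of the premises of the sequence of bipoles. That a rule corresponds to a
sequence of bipoles means: the bipoles decide on the translations of the principal formulas of the rule
(for an initial rule, on the positive literal), and each premise of the sequence extends its conclusion
`⊢ Θ ⇑ ·` exactly by the translations of the formulas and of the relational atom that are active in
the corresponding premise of the rule. -/

/-- Emulation of labeled sequent proofs. A labeled formula `x : A` becomes `[A]_x`. -/
def LS.Emul {α : Type u} : {G : Finset (ℕ × ℕ)} → {Δ : Multiset (ℕ × Modal α)} → LS G Δ →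
    {Θ : Multiset (Form α 0)} → LKF (.async Θ 0) → Prop
  | _, _, .init _ x p, _, d => Bipoles d [tr (.atom p) x] []
  | _, _, .and x A B q₁ q₂, Θ, d =>
      ∃ (d₁ : LKF (.async (dtr A x ::ₘ Θ) 0)) (d₂ : LKF (.async (dtr B x ::ₘ Θ) 0)),
        Bipoles d [dtr (.and A B) x] [⟨_, d₁⟩, ⟨_, d₂⟩] ∧ q₁.Emul d₁ ∧ q₂.Emul d₂
  | _, _, .or x A B q₁, Θ, d =>
      ∃ d₁ : LKF (.async (dtr B x ::ₘ dtr A x ::ₘ Θ) 0),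
        Bipoles d [dtr (.or A B) x] [⟨_, d₁⟩] ∧ q₁.Emul d₁
  | _, _, .box x y A _ _ _ q₁, Θ, d =>
      ∃ d₁ : LKF (.async (dtr A y ::ₘ notR x y ::ₘ Θ) 0),
        Bipoles d [dtr (.box A) x] [⟨_, d₁⟩] ∧ q₁.Emul d₁
  | _, _, .dia x y A _ q₁, Θ, d =>
      ∃ d₁ : LKF (.async (dtr A y ::ₘ Θ) 0),
        Bipoles d [dtr (.dia A) x] [⟨_, d₁⟩] ∧ q₁.Emul d₁

/-- Emulation of prefixed tableaux. The function `ρ` maps the prefixes on the branch to variables;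
since tableaux refute, a prefixed formula `σ : A` becomes the translation of the negation of `A`. -/
def PT.Emul {α : Type u} : {b : List (Prefix × Modal α)} → PT b → (Prefix → ℕ) →
    {Θ : Multiset (Form α 0)} → LKF (.async Θ 0) → Prop
  | _, .close σ p _ _, ρ, _, d => Bipoles d [tr (.atom p) (ρ σ)] []
  | _, .and σ A B _ q₁, ρ, Θ, d =>
      ∃ d₁ : LKF (.async (dtr B.neg (ρ σ) ::ₘ dtr A.neg (ρ σ) ::ₘ Θ) 0),
        Bipoles d [dtr (Modal.and A B).neg (ρ σ)] [⟨_, d₁⟩] ∧ q₁.Emul ρ d₁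
  | _, .or σ A B _ q₁ q₂, ρ, Θ, d =>
      ∃ (d₁ : LKF (.async (dtr A.neg (ρ σ) ::ₘ Θ) 0))
        (d₂ : LKF (.async (dtr B.neg (ρ σ) ::ₘ Θ) 0)),
        Bipoles d [dtr (Modal.or A B).neg (ρ σ)] [⟨_, d₁⟩, ⟨_, d₂⟩] ∧
          q₁.Emul ρ d₁ ∧ q₂.Emul ρ d₂
  | _, .box σ n A _ _ q₁, ρ, Θ, d =>
      ∃ d₁ : LKF (.async (dtr A.neg (ρ (σ ++ [n])) ::ₘ Θ) 0),
        Bipoles d [dtr (Modal.box A).neg (ρ σ)] [⟨_, d₁⟩] ∧ q₁.Emul ρ d₁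
  | _, .dia σ n A _ _ q₁, ρ, Θ, d =>
      ∃ (y : ℕ) (d₁ : LKF (.async (dtr A.neg y ::ₘ notR (ρ σ) y ::ₘ Θ) 0)),
        Bipoles d [dtr (Modal.dia A).neg (ρ σ)] [⟨_, d₁⟩] ∧
          q₁.Emul (Function.update ρ (σ ++ [n]) y) d₁

/-- Emulation of ordinary sequent proofs. The variable `x` is the current world. The modal rule
corresponds to a bipole on the principal `□`-formula, followed by one bipole on each of the principal
`◇`-formulas. -/
def OS.Emul {α : Type u} : {Γ : Multiset (Modal α)} → OS Γ → ℕ →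
    {Θ : Multiset (Form α 0)} → LKF (.async Θ 0) → Prop
  | _, .init _ p, x, _, d => Bipoles d [tr (.atom p) x] []
  | _, .and A B q₁ q₂, x, Θ, d =>
      ∃ (d₁ : LKF (.async (dtr A x ::ₘ Θ) 0)) (d₂ : LKF (.async (dtr B x ::ₘ Θ) 0)),
        Bipoles d [dtr (.and A B) x] [⟨_, d₁⟩, ⟨_, d₂⟩] ∧ q₁.Emul x d₁ ∧ q₂.Emul x d₂
  | _, .or A B q₁, x, Θ, d =>
      ∃ d₁ : LKF (.async (dtr B x ::ₘ dtr A x ::ₘ Θ) 0),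
        Bipoles d [dtr (.or A B) x] [⟨_, d₁⟩] ∧ q₁.Emul x d₁
  | _, .box Γ _ A q₁, x, Θ, d =>
      ∃ (l : List (Modal α)) (y : ℕ)
        (d₁ : LKF (.async (Γ.map (fun B => dtr B y) + dtr A y ::ₘ notR x y ::ₘ Θ) 0)),
        (l : Multiset (Modal α)) = Γ ∧
          Bipoles d (dtr (.box A) x :: l.map (fun B => dtr (.dia B) x)) [⟨_, d₁⟩] ∧
          q₁.Emul y d₁

/-- Emulation of nested sequent proofs. The function `ρ` maps the nodes of the nested sequent, given
by their paths from the root, to variables. -/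
def NS.Emul {α : Type u} : {M : Nested α} → NS M → (List ℕ → ℕ) →
    {Θ : Multiset (Form α 0)} → LKF (.async Θ 0) → Prop
  | _, .init C p, ρ, _, d => Bipoles d [tr (.atom p) (ρ C.path)] []
  | _, .and C A B q₁ q₂, ρ, Θ, d =>
      ∃ (d₁ : LKF (.async (dtr A (ρ C.path) ::ₘ Θ) 0))
        (d₂ : LKF (.async (dtr B (ρ C.path) ::ₘ Θ) 0)),
        Bipoles d [dtr (.and A B) (ρ C.path)] [⟨_, d₁⟩, ⟨_, d₂⟩] ∧ q₁.Emul ρ d₁ ∧ q₂.Emul ρ d₂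
  | _, .or C A B q₁, ρ, Θ, d =>
      ∃ d₁ : LKF (.async (dtr B (ρ C.path) ::ₘ dtr A (ρ C.path) ::ₘ Θ) 0),
        Bipoles d [dtr (.or A B) (ρ C.path)] [⟨_, d₁⟩] ∧ q₁.Emul ρ d₁
  | _, .box C A q₁, ρ, Θ, d =>
      ∃ (y : ℕ) (d₁ : LKF (.async (dtr A y ::ₘ notR (ρ C.path) y ::ₘ Θ) 0)),
        Bipoles d [dtr (.box A) (ρ C.path)] [⟨_, d₁⟩] ∧
          q₁.Emul (Function.update ρ (C.path ++ [C.width]) y) d₁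
  | _, .dia C A _ _ q₁, ρ, Θ, d =>
      ∃ d₁ : LKF (.async (dtr A (ρ (C.path ++ [C.width])) ::ₘ Θ) 0),
        Bipoles d [dtr (.dia A) (ρ C.path)] [⟨_, d₁⟩] ∧ q₁.Emul ρ d₁

/-! ## The four systems together -/

/-- The four proof systems. -/
inductive Calculus : Type
  | LS
  | PT
  | OS
  | NS

/-- The proofs of `A` in each of the systems; in the labeled calculus, `x` is the label of `A`. The
other systems do not depend on `x`. A tableau proof of `A` starts from the negation of `A`. -/
def Calculus.Proof {α : Type u} : Calculus → Modal α → ℕ → Type u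
  | .LS, A, x => ModalCert.LS ∅ {(x, A)}
  | .PT, A, _ => ModalCert.PT [([1], A.neg)]
  | .OS, A, _ => ModalCert.OS {A}
  | .NS, A, _ => ModalCert.NS (Nested.single A)

/-- `A` is provable in the given system (in the labeled calculus: with any label). -/
def Calculus.Provable {α : Type u} (X : Calculus) (A : Modal α) : Prop :=
  ∀ x : ℕ, Nonempty (X.Proof A x)

/-- An LKF proof of the sequent `⊢ Θ ⇑ ·` emulates a proof of `A`; `x` is the variable for the world
at which `A` is evaluated. -/
def Calculus.Emulates {α : Type u} : (X : Calculus) → {A : Modal α} → {x : ℕ} → X.Proof A x →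
    {Θ : Multiset (Form α 0)} → LKF (.async Θ 0) → Prop
  | .LS, _, _, q, _, d => ModalCert.LS.Emul q d
  | .PT, _, x, q, _, d => ModalCert.PT.Emul q (fun _ => x) d
  | .OS, _, x, q, _, d => ModalCert.OS.Emul q x d
  | .NS, _, x, q, _, d => ModalCert.NS.Emul q (fun _ => x) d

end ModalCert

namespace ModalCert

universe u

/-! ## Semantics and completeness of the ordinary sequent calculus -/

/-! Validity in finite Kripke trees links all the provability statements. Take the set of all such
trees as a first-order structure, with "is a child of" as `R`. In it `[A]_x` says that `A` holds at
the root of the tree assigned to `x` (`eval_trans`). Polarities, delays and focusing do not affect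
truth, and cut preserves it, so whatever LKF proves is true there under every assignment
(`LKF.sound`); no cut elimination is needed. Conversely, backward proof search makes OS complete for
finite trees (`OS.complete`): a sequent whose search fails yields a countermodel, with one child for
each `□`-formula. An OS proof can be rewritten in the other systems, because its modal rule is one
`□`-step followed by one `◇`-step for each formula in `Γ` (`OS.toLS`, `OS.toPT`, `OS.toNS`). Hence
an LKF proof of either sequent gives a proof in every system.

The other direction is the emulation itself. The delays make a bipole process exactly one modal
connective: `∂⁺` lets a negative formula be stored and later decided on, `∂⁻` stops the synchronous
phase after the guard `R(x,y)`. This gives one bipole per connective (`exists_bipole_and`,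
`exists_bipole_or`, `exists_bipole_box`, `exists_bipole_dia`), and induction on the given proof
strings them together (`Calculus.exists_emulates`). LKF keeps every stored formula, so the invariant
only asks that the storage contain the translations of the current sequent and of its edges, apart
from conditions on variables or on the tree of worlds. Emulation followed by `LKF.sound` also shows
that the four systems are sound. -/

/-- Finite Kripke trees. -/
inductive Tree (α : Type u) : Type u
  | node (val : α → Prop) (children : List (Tree α)) : Tree α

/-- The propositional symbols that are true at the root. -/
def Tree.val {α : Type u} : Tree α → α → Prop
  | .node v _ => v

/-- The immediate subtrees. -/
def Tree.children {α : Type u} : Tree α → List (Tree α)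
  | .node _ l => l

/-- Truth of a modal formula at the root of a Kripke tree. -/
def Modal.Sat {α : Type u} : Modal α → Tree α → Prop
  | .atom p, t => t.val p
  | .natom p, t => ¬ t.val p
  | .or A B, t => A.Sat t ∨ B.Sat t
  | .and A B, t => A.Sat t ∧ B.Sat t
  | .box A, t => ∀ s ∈ t.children, A.Sat s
  | .dia A, t => ∃ s ∈ t.children, A.Sat s

/-- The number of symbols of a modal formula. -/
def Modal.size {α : Type u} : Modal α → ℕ
  | .atom _ => 1
  | .natom _ => 1
  | .or A B => A.size + B.size + 1
  | .and A B => A.size + B.size + 1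
  | .box A => A.size + 1
  | .dia A => A.size + 1

theorem exists_modal_decomposition {α : Type u} (Γ : Multiset (Modal α)) :
    ∃ D E Λ : Multiset (Modal α), Γ = D.map .dia + E.map .box + Λ ∧
      ∀ B, .dia B ∉ Λ ∧ .box B ∉ Λ := by
  induction Γ using Multiset.induction with
  | empty => exact ⟨0, 0, 0, by simp⟩
  | cons C Γ ih =>
    obtain ⟨D, E, Λ, rfl, h⟩ := ih
    cases C with
    | dia C => exact ⟨C ::ₘ D, E, Λ, by simp, h⟩
    | box C => exact ⟨D, C ::ₘ E, Λ, by simp, h⟩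
    | _ =>
      refine ⟨D, E, _ ::ₘ Λ, (Multiset.add_cons _ _ _).symm, fun B => ?_⟩
      simpa using h B

theorem sum_size_le_sum_size_map_dia {α : Type u} (D : Multiset (Modal α)) :
    (D.map Modal.size).sum ≤ ((D.map Modal.dia).map Modal.size).sum := by
  rw [Multiset.map_map]
  exact Multiset.sum_map_le_sum_map _ _ fun B _ => Nat.le_succ _

/-- Completeness of the ordinary sequent calculus for finite Kripke trees. -/
theorem OS.complete {α : Type u} (Γ : Multiset (Modal α)) (valid : ∀ t, ∃ B ∈ Γ, B.Sat t) :
    Nonempty (OS Γ) := by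
  -- The total number of symbols drops from conclusion to premise in every rule, including the modal
  -- one.
  induction hn : (Γ.map Modal.size).sum using Nat.strong_induction_on generalizing Γ with
  | _ n ih =>
  subst hn
  by_cases hand : ∃ A B, Modal.and A B ∈ Γ
  · obtain ⟨A, B, h⟩ := hand
    obtain ⟨Γ, rfl⟩ := Multiset.exists_cons_of_mem h
    have hA : Nonempty (OS (A ::ₘ Γ)) := ih _ (by simp only [Multiset.map_cons, Multiset.sum_cons, Modal.size]; omega) _ (fun t => by
      obtain ⟨C, hC, hs⟩ := valid t
      rcases Multiset.mem_cons.1 hC with rfl | hC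
      · exact ⟨A, by simp, hs.1⟩
      · exact ⟨C, by simp [hC], hs⟩) rfl
    have hB : Nonempty (OS (B ::ₘ Γ)) := ih _ (by simp only [Multiset.map_cons, Multiset.sum_cons, Modal.size]; omega) _ (fun t => by
      obtain ⟨C, hC, hs⟩ := valid t
      rcases Multiset.mem_cons.1 hC with rfl | hC
      · exact ⟨B, by simp, hs.2⟩
      · exact ⟨C, by simp [hC], hs⟩) rfl
    exact ⟨.and A B hA.some hB.some⟩
  by_cases hor : ∃ A B, Modal.or A B ∈ Γ
  · obtain ⟨A, B, h⟩ := hor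
    obtain ⟨Γ, rfl⟩ := Multiset.exists_cons_of_mem h
    have hAB : Nonempty (OS (A ::ₘ B ::ₘ Γ)) := ih _ (by simp only [Multiset.map_cons, Multiset.sum_cons, Modal.size]; omega) _ (fun t => by
      obtain ⟨C, hC, hs⟩ := valid t
      rcases Multiset.mem_cons.1 hC with rfl | hC
      · rcases hs with hs | hs
        · exact ⟨A, by simp, hs⟩
        · exact ⟨B, by simp, hs⟩
      · exact ⟨C, by simp [hC], hs⟩) rfl
    exact ⟨.or A B hAB.some⟩
  by_contra hne
  obtain ⟨D, E, Λ, rfl, hΛ⟩ := exists_modal_decomposition Γ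
  -- If no tree refuted `A` together with all of `D`, then `A, D` would be valid, hence derivable by
  -- induction, and the modal rule would derive the whole sequent.
  have counter : ∀ A ∈ E, ∃ t : Tree α, ¬ A.Sat t ∧ ∀ B ∈ D, ¬ B.Sat t := by
    intro A hA
    by_contra! hc
    obtain ⟨E, rfl⟩ := Multiset.exists_cons_of_mem hA
    have hAD : Nonempty (OS (A ::ₘ D)) := ih _ (by
      have hs := sum_size_le_sum_size_map_dia D
      have hA : (Modal.box A).size = A.size + 1 := rfl
      rw [Multiset.map_add, Multiset.map_add, Multiset.map_cons Modal.box, Multiset.map_cons,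
        Multiset.map_cons, Multiset.sum_add, Multiset.sum_add, Multiset.sum_cons,
        Multiset.sum_cons, hA]
      omega) _ (fun t => by
      by_cases ht : A.Sat t
      · exact ⟨A, by simp, ht⟩
      · obtain ⟨B, hB, hBt⟩ := hc t ht
        exact ⟨B, by simp [hB], hBt⟩) rfl
    refine hne ⟨?_⟩
    have := OS.box D (E.map .box + Λ) A hAD.some
    rwa [← Multiset.cons_add, ← Multiset.map_cons Modal.box, ← add_assoc] at this
  choose f hf using counter
  -- The countermodel: a symbol is true at the root iff its negation occurs in the sequent, and each
  -- `□A` contributes the child that refutes `A` and all of `D`. Every formula of the sequent fails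
  -- at this root, or the sequent is an axiom.
  obtain ⟨C, hC, hs⟩ := valid (Tree.node (fun p => Modal.natom p ∈ Λ)
    (E.toList.attach.map fun A : {A // A ∈ E.toList} => f A.1 (Multiset.mem_toList.1 A.2)))
  rw [Multiset.mem_add, Multiset.mem_add] at hC
  rcases hC with (hC | hC) | hC
  · obtain ⟨B, hB, rfl⟩ := Multiset.mem_map.1 hC
    obtain ⟨s, hmem, hs⟩ := hs
    obtain ⟨A, -, rfl⟩ := List.mem_map.1 hmem
    exact (hf A.1 (Multiset.mem_toList.1 A.2)).2 B hB hs
  · obtain ⟨A, hA, rfl⟩ := Multiset.mem_map.1 hC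
    exact (hf A hA).1 (hs _ (List.mem_map.2 ⟨⟨A, Multiset.mem_toList.2 hA⟩, by simp, rfl⟩))
  · cases C with
    | atom p =>
      obtain ⟨Λ, rfl⟩ := Multiset.exists_cons_of_mem hC
      have hp : Modal.natom p ∈ Modal.atom p ::ₘ Λ := hs
      obtain ⟨Λ, rfl⟩ := Multiset.exists_cons_of_mem (by simpa using hp : Modal.natom p ∈ Λ)
      have h := OS.init (D.map .dia + E.map .box + Λ) p
      rw [← Multiset.add_cons, ← Multiset.add_cons] at h
      exact hne ⟨h⟩
    | natom p => exact hs hC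
    | or A B => exact hor ⟨A, B, by simp [hC]⟩
    | and A B => exact hand ⟨A, B, by simp [hC]⟩
    | box A => exact (hΛ A).2 hC
    | dia A => exact (hΛ A).1 hC

/-! ## Soundness of LKF -/

/-- The value of a term. -/
def Term.eval {W : Type u} (e : ℕ → W) {n : ℕ} (b : Fin n → W) : Term n → W :=
  Sum.elim e b

/-- Truth of a first-order formula in the structure of Kripke trees. -/
def Form.eval {α : Type u} (e : ℕ → Tree α) : {n : ℕ} → (Fin n → Tree α) → Form α n → Prop
  | _, b, .atom p t => (t.eval e b).val p
  | _, b, .natom p t => ¬ (t.eval e b).val p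
  | _, b, .rel s t => t.eval e b ∈ (s.eval e b).children
  | _, b, .nrel s t => t.eval e b ∉ (s.eval e b).children
  | _, _, .truePos => True
  | _, _, .trueNeg => True
  | _, _, .falsePos => False
  | _, _, .falseNeg => False
  | _, b, .andPos A B => A.eval e b ∧ B.eval e b
  | _, b, .andNeg A B => A.eval e b ∧ B.eval e b
  | _, b, .orPos A B => A.eval e b ∨ B.eval e b
  | _, b, .orNeg A B => A.eval e b ∨ B.eval e b
  | _, b, .all B => ∀ w, B.eval e (Fin.snoc b w : Fin (_ + 1) → Tree α)
  | _, b, .ex B => ∃ w, B.eval e (Fin.snoc b w : Fin (_ + 1) → Tree α)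

theorem Term.eval_inst {W : Type u} (e : ℕ → W) (y : ℕ) {n : ℕ} (b : Fin n → W)
    (t : Term (n + 1)) :
    (t.inst y).eval e b = t.eval e (Fin.cons (e y) b : Fin (n + 1) → W) := by
  rcases t with z | i
  · rfl
  · refine Fin.cases ?_ (fun i => ?_) i <;> rfl

/-- Bound variables are numbered from the outermost binder inwards. Instantiation therefore fills
position 0 (`Fin.cons`), while a quantifier inside the formula appends its value at the end
(`Fin.snoc`); the two operations commute. -/
theorem Form.eval_inst {α : Type u} (e : ℕ → Tree α) (y : ℕ) :
    ∀ {n : ℕ} (b : Fin n → Tree α) (F : Form α (n + 1)),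
      (F.inst y).eval e b ↔ F.eval e (Fin.cons (e y) b : Fin (n + 1) → Tree α)
  | _, _, .atom _ _ | _, _, .natom _ _ | _, _, .rel _ _ | _, _, .nrel _ _ => by
    simp only [Form.inst, Form.eval, Term.eval_inst]
  | _, _, .truePos | _, _, .trueNeg | _, _, .falsePos | _, _, .falseNeg => by
    simp only [Form.inst, Form.eval]
  | _, b, .andPos A B | _, b, .andNeg A B | _, b, .orPos A B | _, b, .orNeg A B => by
    simp only [Form.inst, Form.eval, Form.eval_inst e y b A, Form.eval_inst e y b B]
  | _, b, .all B | _, b, .ex B => by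
    simp only [Form.inst, Form.eval, Form.eval_inst e y _ B, Fin.cons_snoc_eq_snoc_cons]

theorem Term.eval_update {W : Type u} (e : ℕ → W) (y : ℕ) (w : W) {n : ℕ} (b : Fin n → W)
    (t : Term n) (h : t ≠ .inl y) : t.eval (Function.update e y w) b = t.eval e b := by
  rcases t with z | i
  · exact Function.update_of_ne (fun hz => h (congrArg Sum.inl hz)) _ _
  · rfl

theorem Form.eval_update {α : Type u} (e : ℕ → Tree α) (y : ℕ) (w : Tree α) :
    ∀ {n : ℕ} (b : Fin n → Tree α) (F : Form α n), ¬ F.Free y →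
      (F.eval (Function.update e y w) b ↔ F.eval e b)
  | _, b, .atom _ t, h | _, b, .natom _ t, h => by
    simp only [Form.eval, Term.eval_update e y w b t h]
  | _, b, .rel s t, h | _, b, .nrel s t, h => by
    obtain ⟨hs, ht⟩ := not_or.1 h
    simp only [Form.eval, Term.eval_update e y w b t ht, Term.eval_update e y w b s hs]
  | _, _, .truePos, _ | _, _, .trueNeg, _ | _, _, .falsePos, _ | _, _, .falseNeg, _ => Iff.rfl
  | _, b, .andPos A B, h | _, b, .andNeg A B, h | _, b, .orPos A B, h | _, b, .orNeg A B, h => by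
    obtain ⟨hA, hB⟩ := not_or.1 h
    simp only [Form.eval, Form.eval_update e y w b A hA, Form.eval_update e y w b B hB]
  | _, b, .all B, h | _, b, .ex B, h => by
    simp only [Form.eval, Form.eval_update e y w _ B h]

theorem Form.eval_neg {α : Type u} (e : ℕ → Tree α) :
    ∀ {n : ℕ} (b : Fin n → Tree α) (F : Form α n), F.neg.eval e b ↔ ¬ F.eval e b
  | _, _, .atom _ _ | _, _, .natom _ _ | _, _, .rel _ _ | _, _, .nrel _ _ | _, _, .truePos
  | _, _, .trueNeg | _, _, .falsePos | _, _, .falseNeg => by simp [Form.neg, Form.eval]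
  | _, b, .andPos A B | _, b, .andNeg A B | _, b, .orPos A B | _, b, .orNeg A B => by
    simp only [Form.neg, Form.eval, Form.eval_neg e b A, Form.eval_neg e b B]
    tauto
  | _, b, .all B | _, b, .ex B => by
    simp only [Form.neg, Form.eval, Form.eval_neg e _ B, not_forall, not_exists]

/-- The formulas of a sequent. -/
def Sequent.formulas {α : Type u} : Sequent α → Multiset (Form α 0)
  | .async Θ Γ => Γ + Θ
  | .sync Θ B => B ::ₘ Θ

/-- In the structure of Kripke trees, one of the given formulas is true. -/
def Holds {α : Type u} (e : ℕ → Tree α) (Γ : Multiset (Form α 0)) : Prop :=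
  ∃ F ∈ Γ, F.eval e Fin.elim0

@[simp]
theorem holds_cons {α : Type u} (e : ℕ → Tree α) (F : Form α 0) (Γ : Multiset (Form α 0)) :
    Holds e (F ::ₘ Γ) ↔ F.eval e Fin.elim0 ∨ Holds e Γ := by
  simp [Holds]

@[simp]
theorem holds_add {α : Type u} (e : ℕ → Tree α) (Γ Δ : Multiset (Form α 0)) :
    Holds e (Γ + Δ) ↔ Holds e Γ ∨ Holds e Δ := by
  simp [Holds, or_and_right, exists_or]

@[simp]
theorem holds_singleton {α : Type u} (e : ℕ → Tree α) (F : Form α 0) :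
    Holds e {F} ↔ F.eval e Fin.elim0 := by
  simp [Holds]

theorem holds_update {α : Type u} {e : ℕ → Tree α} {y : ℕ} {w : Tree α}
    {Γ : Multiset (Form α 0)} (h : ∀ F ∈ Γ, ¬ F.Free y) :
    Holds (Function.update e y w) Γ ↔ Holds e Γ :=
  exists_congr fun F => and_congr_right fun hF => Form.eval_update e y w _ F (h F hF)

/-- With a single bound variable, the first position is also the last, so instantiation agrees with
the clause for quantifiers. -/
theorem eval_inst_elim0 {α : Type u} (e : ℕ → Tree α) (y : ℕ) (B : Form α 1) :
    (B.inst y).eval e Fin.elim0 ↔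
      B.eval e (Fin.snoc (Fin.elim0 : Fin 0 → Tree α) (e y) : Fin 1 → Tree α) := by
  rw [Form.eval_inst]
  have : (Fin.cons (e y) Fin.elim0 : Fin 1 → Tree α) = Fin.snoc Fin.elim0 (e y) := by
    ext i
    fin_cases i
    rfl
  rw [this]

/-- Both kinds of sequent are read as the disjunction of all their formulas. Under this reading
`store` and `release` change nothing, and `decide` is a contraction. -/
theorem LKF.sound {α : Type u} {S : Sequent α} (d : LKF S) : ∀ e, Holds e S.formulas := by
  induction d with
  | andNeg A B _ _ ih₁ ih₂ =>
    intro e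
    have h₁ := ih₁ e
    have h₂ := ih₂ e
    simp only [Sequent.formulas, holds_add, holds_cons, Form.eval] at h₁ h₂ ⊢
    tauto
  | orNeg A B _ ih =>
    intro e
    have h := ih e
    simp only [Sequent.formulas, holds_add, holds_cons, Form.eval] at h ⊢
    tauto
  | all B y hΘ hΓ hB _ ih =>
    intro e
    simp only [Sequent.formulas, holds_add, holds_cons, Form.eval] at ih ⊢
    by_contra! hc
    obtain ⟨⟨⟨w, hw⟩, hΓ'⟩, hΘ'⟩ := hc
    -- The eigenvariable is reassigned to the counterexample `w`; freshness keeps the side formulas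
    -- false.
    rcases ih (Function.update e y w) with (h | h) | h
    · rw [eval_inst_elim0, Form.eval_update _ _ _ _ _ hB, Function.update_self] at h
      exact hw h
    · exact hΓ' ((holds_update hΓ).1 h)
    · exact hΘ' ((holds_update hΘ).1 h)
  | ex B t _ ih =>
    intro e
    have h := ih e
    simp only [Sequent.formulas, holds_cons, Form.eval, eval_inst_elim0] at h ⊢
    exact h.imp_left fun h => ⟨_, h⟩
  | cut B _ _ ih₁ ih₂ =>
    intro e
    have h₁ := ih₁ e
    have h₂ := ih₂ e
    simp only [Sequent.formulas, holds_add, holds_singleton, Form.eval_neg, zero_add] at h₁ h₂ ⊢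
    tauto
  | @init Θ P _ mem =>
    intro e
    simp only [Sequent.formulas, holds_cons]
    by_cases hP : P.eval e Fin.elim0
    · exact .inl hP
    · exact .inr ⟨_, mem, (Form.eval_neg e _ P).2 hP⟩
  | decide P _ mem _ ih =>
    intro e
    have h := ih e
    simp only [Sequent.formulas, holds_cons, zero_add] at h ⊢
    exact h.elim (fun h => ⟨P, mem, h⟩) id
  | _ =>
    intro e
    simp_all only [Sequent.formulas, holds_add, holds_cons, Form.eval, true_or, false_or,
      Multiset.singleton_add] <;>
    grind

/-! ### The translation expresses Kripke semantics -/

theorem Form.eval_delay {α : Type u} (e : ℕ → Tree α) {n : ℕ} (b : Fin n → Tree α)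
    (F : Form α n) : F.delay.eval e b ↔ F.eval e b := by
  unfold Form.delay
  split <;> simp [Form.delayPos, Form.eval]

theorem eval_trans {α : Type u} (e : ℕ → Tree α) (A : Modal α) :
    ∀ {n : ℕ} (b : Fin n → Tree α) (t : Term n), (trans A t).eval e b ↔ A.Sat (t.eval e b) := by
  have weaken : ∀ {n : ℕ} (b : Fin n → Tree α) (t : Term n) (w : Tree α),
      Term.eval e (Fin.snoc b w : Fin (n + 1) → Tree α) (t.map id Fin.castSucc) = t.eval e b := by
    rintro n b (z | i) w
    · rfl
    · exact Fin.snoc_castSucc (α := fun _ => Tree α) w b i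
  have new : ∀ {n : ℕ} (b : Fin n → Tree α) (w : Tree α),
      Term.eval e (Fin.snoc b w : Fin (n + 1) → Tree α) (.inr (Fin.last n)) = w :=
    fun b w => Fin.snoc_last (α := fun _ => Tree α) w b
  induction A with
  | atom p => intros; rfl
  | natom p => intros; rfl
  | or A B ihA ihB => intros; simp only [trans, Form.eval, Form.eval_delay, ihA, ihB, Modal.Sat]
  | and A B ihA ihB => intros; simp only [trans, Form.eval, Form.eval_delay, ihA, ihB, Modal.Sat]
  | box A ih =>
    intros
    simp only [trans, Form.eval, Form.eval_delay, ih, Modal.Sat, weaken, new, imp_iff_not_or]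
  | dia A ih =>
    intros
    simp only [trans, Form.eval, Form.delayNeg, Form.eval_delay, ih, Modal.Sat, weaken, new,
      false_or]

theorem sat_of_LKF_tr {α : Type u} {A : Modal α} {x : ℕ} (d : LKF (.async 0 {tr A x}))
    (t : Tree α) : A.Sat t := by
  have h := d.sound fun _ => t
  simpa [Sequent.formulas, tr, eval_trans, Term.eval] using h

theorem sat_of_LKF_dtr {α : Type u} {A : Modal α} {x : ℕ} (d : LKF (.async {dtr A x} 0))
    (t : Tree α) : A.Sat t := by
  have h := d.sound fun _ => t
  simpa [Sequent.formulas, dtr, tr, eval_trans, Form.eval_delay, Term.eval] using h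

/-! ## Translations of ordinary sequent proofs into the other systems -/

/-- The `◇`-part of the modal rule of OS: one `◇`-step per formula. `Δ` is arbitrary so that it can
absorb the formulas already treated. -/
theorem LS.nonempty_of_dia {α : Type u} {G : Finset (ℕ × ℕ)} {x y : ℕ} (rel : (x, y) ∈ G)
    (Γ : Multiset (Modal α)) : ∀ Δ : Multiset (ℕ × Modal α),
    Nonempty (LS G (Γ.map (fun B => (y, B)) + (Γ.map (fun B => (x, .dia B)) + Δ))) →
    Nonempty (LS G (Γ.map (fun B => (x, .dia B)) + Δ)) := by
  induction Γ using Multiset.induction with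
  | empty => simp
  | cons B Γ ih =>
    rintro Δ ⟨q⟩
    obtain ⟨r⟩ := ih ((x, .dia B) ::ₘ (y, B) ::ₘ Δ) ⟨by
      convert q using 1
      simp only [Multiset.map_cons, Multiset.cons_add, Multiset.add_cons]⟩
    refine ⟨?_⟩
    rw [Multiset.map_cons, Multiset.cons_add]
    refine .dia x y B rel ?_
    simpa only [Multiset.add_cons] using r

/-- The arbitrary `G` and `Δ` build weakening into the induction: when the OS proof moves to a new
world, the labeled sequent keeps the old edges and the other formulas of the old world. -/
theorem OS.toLS {α : Type u} {Γ : Multiset (Modal α)} (q : OS Γ) :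
    ∀ (x : ℕ) (G : Finset (ℕ × ℕ)) (Δ : Multiset (ℕ × Modal α)),
      Nonempty (LS G (Γ.map (fun B => (x, B)) + Δ)) := by
  induction q with
  | init Γ p =>
    intro x G Δ
    simp only [Multiset.map_cons, Multiset.cons_add]
    rw [Multiset.cons_swap]
    exact ⟨.init _ x p⟩
  | and A B _ _ ih₁ ih₂ =>
    intro x G Δ
    have h₁ := ih₁ x G Δ
    have h₂ := ih₂ x G Δ
    simp only [Multiset.map_cons, Multiset.cons_add] at h₁ h₂ ⊢
    exact ⟨.and x A B h₁.some h₂.some⟩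
  | or A B _ ih =>
    intro x G Δ
    have h := ih x G Δ
    simp only [Multiset.map_cons, Multiset.cons_add] at h ⊢
    exact ⟨.or x A B h.some⟩
  | box Γ Δ' A _ ih =>
    intro x G Δ
    obtain ⟨y, hy⟩ := Infinite.exists_notMem_finset (insert x (G.image Prod.fst ∪
      G.image Prod.snd ∪ (Δ.map Prod.fst).toFinset))
    simp only [Finset.mem_insert, Finset.mem_union, Finset.mem_image, Multiset.mem_toFinset,
      Multiset.mem_map, not_or, not_exists, not_and] at hy
    obtain ⟨hx, ⟨hG₁, hG₂⟩, hΔ⟩ := hy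
    simp only [Multiset.map_add, Multiset.map_cons, Multiset.map_map, Multiset.cons_add,
      Multiset.add_cons]
    have h : Nonempty (LS (insert (x, y) G) ((y, A) ::ₘ
        (Γ.map (fun B => (x, .dia B)) + (Δ'.map (fun B => (x, B)) + Δ)))) := by
      rw [← Multiset.add_cons]
      refine LS.nonempty_of_dia (y := y) (by simp) Γ _ ?_
      have h := ih y (insert (x, y) G)
        (Γ.map (fun B => (x, .dia B)) + (Δ'.map (fun B => (x, B)) + Δ))
      simpa only [Multiset.map_cons, Multiset.cons_add, Multiset.add_cons] using h
    rw [← add_assoc] at h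
    refine ⟨.box x y A hx (fun e he => ⟨fun h => hG₁ e he h.symm, fun h => hG₂ e he h.symm⟩)
      ?_ h.some⟩
    intro φ hφ
    simp only [Multiset.mem_add, Multiset.mem_map] at hφ
    rcases hφ with (⟨B, -, rfl⟩ | ⟨B, -, rfl⟩) | hφ
    · exact hx
    · exact hx
    · exact fun h => hΔ φ hφ h.symm

/-- Adds the instances of all `□`-formulas at `σ` to the branch, one after the other. Quantifying
over all larger branches `b'` avoids fixing the order in which they are added. -/
theorem PT.nonempty_of_box {α : Type u} (σ : Prefix) (n : ℕ+) (Γ : Multiset (Modal α)) :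
    ∀ b : List (Prefix × Modal α), (∀ B ∈ Γ, (σ, .box B) ∈ b) → (∃ φ ∈ b, φ.1 = σ ++ [n]) →
    (∀ b' : List (Prefix × Modal α), b ⊆ b' → (∀ B ∈ Γ, (σ ++ [n], B) ∈ b') →
      Nonempty (PT b')) → Nonempty (PT b) := by
  induction Γ using Multiset.induction with
  | empty => exact fun b _ _ h => h b (List.Subset.refl b) (by simp)
  | cons B Γ ih =>
    intro b hb used h
    have : Nonempty (PT ((σ ++ [n], B) :: b)) := by
      refine ih _ (fun C hC => List.mem_cons_of_mem _ (hb C (Multiset.mem_cons_of_mem hC)))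
        ⟨_, List.mem_cons_self, rfl⟩ fun b' hb' h' => ?_
      refine h b' (fun φ hφ => hb' (List.mem_cons_of_mem _ hφ)) fun C hC => ?_
      rcases Multiset.mem_cons.1 hC with rfl | hC
      · exact hb' List.mem_cons_self
      · exact h' C hC
    exact ⟨.box σ n B (hb B (Multiset.mem_cons_self _ _)) used this.some⟩

theorem exists_new_prefix {β : Type u} (b : List (Prefix × β)) (σ : Prefix) :
    ∃ n : ℕ+, ∀ φ ∈ b, φ.1 ≠ σ ++ [n] := by
  have inj : Function.Injective fun n : ℕ+ => σ ++ [n] := fun m n h => by simpa using h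
  obtain ⟨_, ⟨n, rfl⟩, hn⟩ :=
    (Set.infinite_range_of_injective inj).exists_notMem_finset (b.map Prod.fst).toFinset
  refine ⟨n, fun φ hφ h => hn ?_⟩
  simp only [List.mem_toFinset, List.mem_map]
  exact ⟨φ, hφ, h⟩

/-- A tableau is a sequent proof of the negated formulas, with `∧`/`∨` and `□`/`◇` exchanged.
Membership in the branch is enough, since branches only grow. -/
theorem OS.toPT {α : Type u} {Γ : Multiset (Modal α)} (q : OS Γ) :
    ∀ (σ : Prefix) (b : List (Prefix × Modal α)), (∀ B ∈ Γ, (σ, B.neg) ∈ b) →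
      Nonempty (PT b) := by
  induction q with
  | init Γ p =>
    intro σ b h
    exact ⟨.close σ p (h (.natom p) (by simp)) (h (.atom p) (by simp))⟩
  | @and Γ A B _ _ ih₁ ih₂ =>
    intro σ b h
    have hΓ : ∀ C ∈ Γ, (σ, C.neg) ∈ b := fun C hC => h C (by simp [hC])
    have h₁ := ih₁ σ ((σ, A.neg) :: b) (by simpa using fun C hC => .inr (hΓ C hC))
    have h₂ := ih₂ σ ((σ, B.neg) :: b) (by simpa using fun C hC => .inr (hΓ C hC))
    exact ⟨.or σ A.neg B.neg (h (.and A B) (by simp)) h₁.some h₂.some⟩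
  | @or Γ A B _ ih =>
    intro σ b h
    have hΓ : ∀ C ∈ Γ, (σ, C.neg) ∈ b := fun C hC => h C (by simp [hC])
    have h₁ := ih σ ((σ, A.neg) :: (σ, B.neg) :: b)
      (by simpa using fun C hC => .inr (.inr (hΓ C hC)))
    exact ⟨.and σ A.neg B.neg (h (.or A B) (by simp)) h₁.some⟩
  | box Γ Δ A _ ih =>
    intro σ b h
    obtain ⟨n, hn⟩ := exists_new_prefix b σ
    have : Nonempty (PT ((σ ++ [n], A.neg) :: b)) := by
      refine PT.nonempty_of_box σ n (Γ.map Modal.neg) _ ?_ ⟨_, List.mem_cons_self, rfl⟩ ?_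
      · intro B hB
        obtain ⟨B, hB', rfl⟩ := Multiset.mem_map.1 hB
        exact List.mem_cons_of_mem _ (h (.dia B) (by simp [hB']))
      · intro b' hb' h'
        refine ih (σ ++ [n]) b' fun B hB => ?_
        rcases Multiset.mem_cons.1 hB with rfl | hB
        · exact hb' List.mem_cons_self
        · exact h' _ (Multiset.mem_map_of_mem _ hB)
    exact ⟨.dia σ n A.neg (h (.box A) (by simp)) hn this.some⟩

/-- The context `C` with the context `D` put in place of the hole. -/
def Context.comp {α : Type u} : Context α → Context α → Context α
  | .here fs bs, .here gs cs => .here (fs + gs) (bs ++ cs)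
  | .here fs bs, .under gs left D right => .under (fs + gs) (bs ++ left) D right
  | .under fs left C right, D => .under fs left (C.comp D) right

theorem Context.fill_comp {α : Type u} (C D : Context α) (M : Nested α) :
    (C.comp D).fill M = C.fill (D.fill M) := by
  induction C with
  | here fs bs =>
    cases D with
    | here gs cs =>
      cases M
      simp only [Context.comp, Context.fill, add_assoc, List.append_assoc]
    | under gs left D right => simp only [Context.comp, Context.fill, List.append_assoc]
  | under fs left C right ih => simp only [Context.comp, Context.fill, ih]

/-- One `◇`-step per formula of `Γ`; `fs` and `gs` absorb the formulas already treated at the outer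
and the inner node. -/
theorem NS.nonempty_of_dia {α : Type u} (C : Context α) (Γ : Multiset (Modal α)) :
    ∀ fs gs : Multiset (Modal α),
      Nonempty (NS (C.fill (.node (Γ.map .dia + fs) [.node (Γ + gs) []]))) →
      Nonempty (NS (C.fill (.node (Γ.map .dia + fs) [.node gs []]))) := by
  induction Γ using Multiset.induction with
  | empty => simp
  | cons B Γ ih =>
    rintro fs gs h
    have h' := ih (.dia B ::ₘ fs) (B ::ₘ gs) (by
      simpa only [Multiset.map_cons, Multiset.cons_add, Multiset.add_cons] using h)
    -- The rule acts on `◇B` alone, so the other formulas of the node are moved into the context.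
    have key : ∀ M : Nested α, (C.comp (.here (Γ.map .dia + fs) [])).fill (.node {.dia B} [M]) =
        C.fill (.node ((B ::ₘ Γ).map .dia + fs) [M]) := by
      intro M
      rw [Context.fill_comp]
      simp only [Context.fill, Multiset.map_cons, List.nil_append]
      rw [add_comm _ {Modal.dia B}, Multiset.singleton_add, Multiset.cons_add]
    rw [← key]
    refine ⟨.dia _ B _ _ ?_⟩
    rw [key, Multiset.map_cons, Multiset.cons_add, ← Multiset.add_cons]
    exact h'.some

/-- The context is arbitrary because the modal rule moves the proof into a new bracket, where the
formulas of the old world become part of the context. -/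
theorem OS.toNS {α : Type u} {Γ : Multiset (Modal α)} (q : OS Γ) :
    ∀ C : Context α, Nonempty (NS (C.fill (.node Γ []))) := by
  have key : ∀ (C : Context α) (Γ gs : Multiset (Modal α)) (bs : List (Nested α)),
      (C.comp (.here Γ [])).fill (.node gs bs) = C.fill (.node (gs + Γ) bs) := by
    intro C Γ gs bs
    rw [Context.fill_comp]
    simp only [Context.fill, List.nil_append, add_comm gs]
  induction q with
  | init Γ p =>
    intro C
    have h := NS.init (C.comp (.here Γ [])) p
    rw [key, Multiset.insert_eq_cons, Multiset.cons_add, Multiset.singleton_add] at h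
    exact ⟨h⟩
  | @and Γ A B _ _ ih₁ ih₂ =>
    intro C
    have h := NS.and (C.comp (.here Γ [])) A B
    simp only [Nested.single, key, Multiset.singleton_add] at h
    exact ⟨h (ih₁ C).some (ih₂ C).some⟩
  | @or Γ A B _ ih =>
    intro C
    have h := NS.or (C.comp (.here Γ [])) A B
    simp only [Nested.single, key, Multiset.singleton_add, Multiset.insert_eq_cons,
      Multiset.cons_add] at h
    exact ⟨h (ih C).some⟩
  | box Γ Δ A _ ih =>
    intro C
    have h := NS.box (C.comp (.here (Γ.map .dia + Δ) [])) A
    simp only [Nested.single, key, Multiset.singleton_add, zero_add] at h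
    rw [Multiset.add_cons]
    have h' := NS.nonempty_of_dia C Γ Δ {A} (by
      -- The hole is placed inside the new bracket, next to `◇Γ, Δ`.
      have := ih (C.comp (.under (Γ.map .dia + Δ) [] (.here 0 []) []))
      rw [Context.fill_comp] at this
      simpa only [Context.fill, List.nil_append, zero_add, add_comm Γ,
        Multiset.singleton_add] using this)
    exact ⟨h h'.some⟩

theorem OS.nonempty_proof {α : Type u} {A : Modal α} (q : OS {A}) (X : Calculus) (x : ℕ) :
    Nonempty (X.Proof A x) := by
  cases X with
  | LS => simpa [Calculus.Proof] using q.toLS x ∅ 0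
  | PT => exact q.toPT [1] _ (by simp)
  | OS => exact ⟨q⟩
  | NS => simpa [Calculus.Proof, Context.fill, Nested.single] using q.toNS (.here 0 [])

theorem Calculus.provable_of_valid {α : Type u} (X : Calculus) {A : Modal α}
    (valid : ∀ t, A.Sat t) : X.Provable A := fun x =>
  (OS.complete {A} fun t => ⟨A, by simp, valid t⟩).elim fun q => q.nonempty_proof X x

/-! ## Free variables and instances of translations -/

namespace Form

/-- This is the purpose of the delay: a subformula is stored as soon as it appears, so the
asynchronous phase stops after one modal connective. -/
theorem delay_store {α : Type u} {n : ℕ} (F : Form α n) : F.delay.Pos ∨ F.delay.NegLit := by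
  unfold delay
  split
  · assumption
  · exact .inl trivial

theorem delay_eq_delayPos {α : Type u} {n : ℕ} {F : Form α n} (h : ¬ F.Pos) (h' : ¬ F.NegLit) :
    F.delay = F.delayPos :=
  if_neg (not_or.2 ⟨h, h'⟩)

theorem pos_inst {α : Type u} (y : ℕ) : ∀ {n : ℕ} (F : Form α (n + 1)), (F.inst y).Pos ↔ F.Pos
  | _, .atom _ _ | _, .natom _ _ | _, .rel _ _ | _, .nrel _ _ | _, .truePos | _, .trueNeg
  | _, .falsePos | _, .falseNeg | _, .andPos _ _ | _, .andNeg _ _ | _, .orPos _ _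
  | _, .orNeg _ _ | _, .all _ | _, .ex _ => by simp only [inst, Pos]

theorem negLit_inst {α : Type u} (y : ℕ) :
    ∀ {n : ℕ} (F : Form α (n + 1)), (F.inst y).NegLit ↔ F.NegLit
  | _, .atom _ _ | _, .natom _ _ | _, .rel _ _ | _, .nrel _ _ | _, .truePos | _, .trueNeg
  | _, .falsePos | _, .falseNeg | _, .andPos _ _ | _, .andNeg _ _ | _, .orPos _ _
  | _, .orNeg _ _ | _, .all _ | _, .ex _ => by simp only [inst, NegLit]

theorem inst_delay {α : Type u} (y : ℕ) {n : ℕ} (F : Form α (n + 1)) :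
    F.delay.inst y = (F.inst y).delay := by
  unfold delay
  rw [pos_inst, negLit_inst]
  split
  · rfl
  · simp only [delayPos, inst]

theorem free_delay {α : Type u} (y : ℕ) {n : ℕ} (F : Form α n) : F.delay.Free y ↔ F.Free y := by
  unfold delay
  split <;> simp [delayPos, Free]

/-- A bound, rather than a single fresh variable, so that several formulas can be combined by taking
maxima. -/
theorem exists_bound_free {α : Type u} :
    ∀ {n : ℕ} (F : Form α n), ∃ N, ∀ y ≥ N, ¬ F.Free y := by
  have term : ∀ {n : ℕ} (t : Term n), ∃ N, ∀ y ≥ N, t ≠ .inl y := by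
    rintro n (z | i)
    · exact ⟨z + 1, fun y hy h => by cases h; omega⟩
    · exact ⟨0, fun y _ h => by cases h⟩
  have both : ∀ {P Q : ℕ → Prop}, (∃ N, ∀ y ≥ N, ¬ P y) → (∃ N, ∀ y ≥ N, ¬ Q y) →
      ∃ N, ∀ y ≥ N, ¬ (P y ∨ Q y) := by
    rintro P Q ⟨M, hM⟩ ⟨N, hN⟩
    exact ⟨max M N, fun y hy => not_or.2 ⟨hM y (le_trans (le_max_left _ _) hy),
      hN y (le_trans (le_max_right _ _) hy)⟩⟩
  intro n F
  induction F with
  | atom p t => exact term t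
  | natom p t => exact term t
  | rel s t => exact both (term s) (term t)
  | nrel s t => exact both (term s) (term t)
  | truePos => exact ⟨0, fun _ _ h => h⟩
  | trueNeg => exact ⟨0, fun _ _ h => h⟩
  | falsePos => exact ⟨0, fun _ _ h => h⟩
  | falseNeg => exact ⟨0, fun _ _ h => h⟩
  | andPos A B ihA ihB => exact both ihA ihB
  | andNeg A B ihA ihB => exact both ihA ihB
  | orPos A B ihA ihB => exact both ihA ihB
  | orNeg A B ihA ihB => exact both ihA ihB
  | all B ih => exact ih
  | ex B ih => exact ih

end Form

theorem exists_fresh {α : Type u} (Θ : Multiset (Form α 0)) : ∃ y, ∀ F ∈ Θ, ¬ F.Free y := by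
  suffices ∃ N, ∀ y ≥ N, ∀ F ∈ Θ, ¬ F.Free y from this.imp fun N h => h N le_rfl
  induction Θ using Multiset.induction with
  | empty => exact ⟨0, by simp⟩
  | cons F Θ ih =>
    obtain ⟨M, hM⟩ := F.exists_bound_free
    obtain ⟨N, hN⟩ := ih
    refine ⟨max M N, fun y hy G hG => ?_⟩
    rcases Multiset.mem_cons.1 hG with rfl | hG
    · exact hM y (le_trans (le_max_left _ _) hy)
    · exact hN y (le_trans (le_max_right _ _) hy) G hG

theorem Term.inst_map_castSucc (y : ℕ) {n : ℕ} (t : Term (n + 1)) :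
    Term.inst y (Sum.map id Fin.castSucc t : Term (n + 2)) =
      Sum.map id Fin.castSucc (t.inst y) := by
  rcases t with z | i
  · rfl
  · refine Fin.cases ?_ (fun i => ?_) i <;> rfl

/-- Makes the premise of a quantifier step again a translation, now at the variable `y`. The
variable of an inner quantifier is the last one, so filling the outermost position does not touch
it. -/
theorem trans_inst {α : Type u} (y : ℕ) (A : Modal α) :
    ∀ {n : ℕ} (t : Term (n + 1)), (trans A t).inst y = trans A (t.inst y) := by
  have last : ∀ n : ℕ, Term.inst y (.inr (Fin.last (n + 1)) : Term (n + 2)) =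
    .inr (Fin.last n) := fun n => rfl
  induction A with
  | atom p => intros; simp only [trans, Form.inst]
  | natom p => intros; simp only [trans, Form.inst]
  | or A B ihA ihB => intros; simp only [trans, Form.inst, Form.inst_delay, ihA, ihB]
  | and A B ihA ihB => intros; simp only [trans, Form.inst, Form.inst_delay, ihA, ihB]
  | box A ih =>
    intros
    simp only [trans, Form.inst, Form.inst_delay, ih, last, Term.inst_map_castSucc]
  | dia A ih =>
    intros
    simp only [trans, Form.inst, Form.delayNeg, Form.inst_delay, ih, last,
      Term.inst_map_castSucc]

theorem free_trans {α : Type u} {y : ℕ} (A : Modal α) :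
    ∀ {n : ℕ} {t : Term n}, (trans A t).Free y → t = .inl y := by
  have weaken : ∀ {n : ℕ} {t : Term n}, (Sum.map id Fin.castSucc t : Term (n + 1)) = .inl y →
      t = .inl y := by
    rintro n (z | i) h
    · simpa using h
    · simp at h
  have new : ∀ {n : ℕ}, (.inr (Fin.last n) : Term (n + 1)) ≠ .inl y := nofun
  induction A with
  | atom p => exact id
  | natom p => exact id
  | or A B ihA ihB =>
    intro n t h
    simp only [trans, Form.Free, Form.free_delay] at h
    exact h.elim ihA ihB
  | and A B ihA ihB =>
    intro n t h
    simp only [trans, Form.Free, Form.free_delay] at h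
    exact h.elim ihA ihB
  | box A ih =>
    intro n t h
    simp only [trans, Form.Free, Form.free_delay, new, or_false] at h
    exact h.elim weaken fun h => (new (ih h)).elim
  | dia A ih =>
    intro n t h
    simp only [trans, Form.Free, Form.delayNeg, Form.free_delay, new, or_false, false_or] at h
    exact h.elim weaken fun h => (new (ih h)).elim

theorem free_dtr {α : Type u} {y x : ℕ} {A : Modal α} (h : (dtr A x).Free y) : x = y := by
  simpa using free_trans A ((Form.free_delay y _).1 h)

/-! ## The shape of translations -/

theorem dtr_atom {α : Type u} (p : α) (x : ℕ) : dtr (.atom p) x = .atom p (.inl x) := by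
  simp [dtr, tr, trans, Form.delay, Form.Pos]

theorem dtr_natom {α : Type u} (p : α) (x : ℕ) : dtr (.natom p) x = .natom p (.inl x) := by
  simp [dtr, tr, trans, Form.delay, Form.NegLit]

theorem dtr_and {α : Type u} (A B : Modal α) (x : ℕ) :
    dtr (.and A B) x = .andPos .truePos (.andNeg (dtr A x) (dtr B x)) :=
  -- For a negative connective, `Pos` and `NegLit` both reduce to `False`, so `id` proves their
  -- negations.
  Form.delay_eq_delayPos id id

theorem dtr_or {α : Type u} (A B : Modal α) (x : ℕ) :
    dtr (.or A B) x = .andPos .truePos (.orNeg (dtr A x) (dtr B x)) :=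
  Form.delay_eq_delayPos id id

/-- The body of the translation of a `□`-formula. -/
noncomputable def boxBody {α : Type u} (A : Modal α) (x : ℕ) : Form α 1 :=
  .orNeg (.nrel (.inl x) (.inr (Fin.last 0))) (trans A (.inr (Fin.last 0))).delay

/-- The body of the translation of a `◇`-formula. -/
noncomputable def diaBody {α : Type u} (A : Modal α) (x : ℕ) : Form α 1 :=
  .andPos (.rel (.inl x) (.inr (Fin.last 0))) (trans A (.inr (Fin.last 0))).delay.delayNeg

theorem tr_box {α : Type u} (A : Modal α) (x : ℕ) : tr (.box A) x = .all (boxBody A x) := rfl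

theorem dtr_box {α : Type u} (A : Modal α) (x : ℕ) :
    dtr (.box A) x = .andPos .truePos (.all (boxBody A x)) :=
  Form.delay_eq_delayPos id id

theorem dtr_dia {α : Type u} (A : Modal α) (x : ℕ) : dtr (.dia A) x = .ex (diaBody A x) := by
  simp [dtr, tr, trans, diaBody, Form.delay, Form.Pos]

theorem boxBody_inst {α : Type u} (A : Modal α) (x y : ℕ) :
    (boxBody A x).inst y = .orNeg (notR x y) (dtr A y) := by
  simp only [boxBody, Form.inst, Form.inst_delay, trans_inst]
  rfl

theorem diaBody_inst {α : Type u} (A : Modal α) (x y : ℕ) :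
    (diaBody A x).inst y = .andPos (.rel (.inl x) (.inl y)) (dtr A y).delayNeg := by
  simp only [diaBody, Form.delayNeg, Form.inst, Form.inst_delay, trans_inst]
  rfl

theorem free_boxBody {α : Type u} {A : Modal α} {x y : ℕ} (h : (boxBody A x).Free y) :
    (dtr (.box A) x).Free y := by
  rw [dtr_box]
  exact .inr h

/-! ## Derivations up to the next decisions -/

/-- There is a proof of `S` in which `L` lists the subproofs that begin with the next decisions. -/
def Reaches {α : Type u} (S : Sequent α) (L : List (SomeLKF α)) : Prop :=
  ∃ d : LKF S, d.frontier = L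

open Sequent

/-- With nothing left to process asynchronously, the last rule is a `decide` or a `cut`, and there
the frontier stops. -/
theorem LKF.frontier_of_async_zero {α : Type u} {Θ : Multiset (Form α 0)} (d : LKF (async Θ 0)) :
    d.frontier = [⟨_, d⟩] := by
  suffices ∀ {S : Sequent α} (d : LKF S), S = async Θ 0 → d.frontier = [⟨_, d⟩] from this d rfl
  intro S d h
  cases d <;> first | rfl | simp at h

namespace Reaches

variable {α : Type u} {Θ Γ : Multiset (Form α 0)} {L L' : List (SomeLKF α)}

theorem of_proof (d : LKF (async Θ 0)) : Reaches (async Θ 0) [⟨_, d⟩] :=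
  ⟨d, d.frontier_of_async_zero⟩

theorem andNeg {A B : Form α 0} (h : Reaches (async Θ (A ::ₘ Γ)) L)
    (h' : Reaches (async Θ (B ::ₘ Γ)) L') :
    Reaches (async Θ (.andNeg A B ::ₘ Γ)) (L ++ L') := by
  obtain ⟨d, rfl⟩ := h
  obtain ⟨e, rfl⟩ := h'
  exact ⟨.andNeg A B d e, rfl⟩

theorem orNeg {A B : Form α 0} (h : Reaches (async Θ (A ::ₘ B ::ₘ Γ)) L) :
    Reaches (async Θ (.orNeg A B ::ₘ Γ)) L := by
  obtain ⟨d, rfl⟩ := h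
  exact ⟨.orNeg A B d, rfl⟩

theorem falseNeg (h : Reaches (async Θ Γ) L) : Reaches (async Θ (.falseNeg ::ₘ Γ)) L := by
  obtain ⟨d, rfl⟩ := h
  exact ⟨.falseNeg d, rfl⟩

theorem all {B : Form α 1} {y : ℕ} (hΘ : ∀ F ∈ Θ, ¬ F.Free y) (hΓ : ∀ F ∈ Γ, ¬ F.Free y)
    (hB : ¬ B.Free y) (h : Reaches (async Θ (B.inst y ::ₘ Γ)) L) :
    Reaches (async Θ (.all B ::ₘ Γ)) L := by
  obtain ⟨d, rfl⟩ := h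
  exact ⟨.all B y hΘ hΓ hB d, rfl⟩

theorem store {C : Form α 0} (pos : C.Pos ∨ C.NegLit) (h : Reaches (async (C ::ₘ Θ) Γ) L) :
    Reaches (async Θ (C ::ₘ Γ)) L := by
  obtain ⟨d, rfl⟩ := h
  exact ⟨.store C pos d, rfl⟩

theorem store_dtr {A : Modal α} {x : ℕ} (h : Reaches (async (dtr A x ::ₘ Θ) Γ) L) :
    Reaches (async Θ (dtr A x ::ₘ Γ)) L :=
  h.store (Form.delay_store _)

theorem release {N : Form α 0} (neg : ¬ N.Pos) (h : Reaches (async Θ (N ::ₘ 0)) L) :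
    Reaches (sync Θ N) L := by
  obtain ⟨d, rfl⟩ := h
  exact ⟨.release N neg d, rfl⟩

theorem delayPos {N : Form α 0} (h : Reaches (sync Θ N) L) :
    Reaches (sync Θ (.andPos .truePos N)) L := by
  obtain ⟨d, rfl⟩ := h
  exact ⟨.andPos _ _ .truePos d, rfl⟩

/-- The focused atom `P` can only be closed by `init`, so its branch contributes nothing to the
frontier. -/
theorem guarded {P N : Form α 0} (lit : P.PosLit) (mem : P.neg ∈ Θ) (h : Reaches (sync Θ N) L) :
    Reaches (sync Θ (.andPos P N)) L := by
  obtain ⟨d, rfl⟩ := h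
  exact ⟨.andPos _ _ (.init P lit mem) d, rfl⟩

theorem ex {B : Form α 1} (t : ℕ) (h : Reaches (sync Θ (B.inst t)) L) :
    Reaches (sync Θ (.ex B)) L := by
  obtain ⟨d, rfl⟩ := h
  exact ⟨.ex B t d, rfl⟩

theorem exists_bipole {P : Form α 0} (pos : P.Pos) (mem : P ∈ Θ) (h : Reaches (sync Θ P) L) :
    ∃ d : LKF (async Θ 0), Bipole d P L := by
  obtain ⟨d, rfl⟩ := h
  exact ⟨.decide P pos mem d, .mk P pos mem d⟩

/-- Stated for the undelayed formula: it serves both inside a bipole and for an end-sequent in which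
`[□A]_x` is not yet stored. -/
theorem box {A : Modal α} {x y : ℕ} (fresh : ∀ F ∈ Θ, ¬ F.Free y)
    (fresh' : ¬ (dtr (.box A) x).Free y)
    (h : Reaches (async (dtr A y ::ₘ notR x y ::ₘ Θ) 0) L) :
    Reaches (async Θ (tr (.box A) x ::ₘ 0)) L := by
  rw [tr_box]
  refine .all (y := y) fresh (by simp) (fun h => fresh' (free_boxBody h)) ?_
  rw [boxBody_inst]
  exact .orNeg (.store (.inr trivial) h.store_dtr)

end Reaches

/-! ### One bipole for each rule -/

section Bipole

variable {α : Type u} {Θ : Multiset (Form α 0)}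

theorem exists_bipole_init {p : α} {x : ℕ} (pos : dtr (.atom p) x ∈ Θ)
    (neg : dtr (.natom p) x ∈ Θ) : ∃ d : LKF (async Θ 0), Bipole d (tr (.atom p) x) [] := by
  rw [dtr_atom] at pos
  rw [dtr_natom] at neg
  exact Reaches.exists_bipole trivial pos ⟨.init _ trivial neg, rfl⟩

/-- Deciding on the delayed formula closes `true` at once and releases the negative conjunction; its
conjuncts are then stored. The cases of `∨` and `□` follow the same pattern. -/
theorem exists_bipole_and {A B : Modal α} {x : ℕ} (mem : dtr (.and A B) x ∈ Θ)
    (d₁ : LKF (async (dtr A x ::ₘ Θ) 0)) (d₂ : LKF (async (dtr B x ::ₘ Θ) 0)) :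
    ∃ d : LKF (async Θ 0), Bipole d (dtr (.and A B) x) [⟨_, d₁⟩, ⟨_, d₂⟩] := by
  rw [dtr_and] at mem ⊢
  exact Reaches.exists_bipole trivial mem (.delayPos (.release id
    -- Fixing the first list tells the unifier how to split the two-element list into an append.
    (.andNeg (L := [_]) (Reaches.of_proof d₁).store_dtr (Reaches.of_proof d₂).store_dtr)))

theorem exists_bipole_or {A B : Modal α} {x : ℕ} (mem : dtr (.or A B) x ∈ Θ)
    (d₁ : LKF (async (dtr B x ::ₘ dtr A x ::ₘ Θ) 0)) :
    ∃ d : LKF (async Θ 0), Bipole d (dtr (.or A B) x) [⟨_, d₁⟩] := by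
  rw [dtr_or] at mem ⊢
  exact Reaches.exists_bipole trivial mem (.delayPos (.release id
    (.orNeg (Reaches.of_proof d₁).store_dtr.store_dtr)))

theorem exists_bipole_box {A : Modal α} {x y : ℕ} (mem : dtr (.box A) x ∈ Θ)
    (fresh : ∀ F ∈ Θ, ¬ F.Free y) (d₁ : LKF (async (dtr A y ::ₘ notR x y ::ₘ Θ) 0)) :
    ∃ d : LKF (async Θ 0), Bipole d (dtr (.box A) x) [⟨_, d₁⟩] := by
  have fresh' := fresh _ mem
  have h := Reaches.box fresh fresh' (.of_proof d₁)
  rw [dtr_box] at mem ⊢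
  exact Reaches.exists_bipole trivial mem (.delayPos (.release id h))

/-- The stored `¬R(x,y)` closes the guard and thus plays the role of the side condition `xRy`.
Without `∂⁻`, a positive `[A]_y` would stay under focus instead of being stored. -/
theorem exists_bipole_dia {A : Modal α} {x y : ℕ} (mem : dtr (.dia A) x ∈ Θ)
    (rel : notR x y ∈ Θ) (d₁ : LKF (async (dtr A y ::ₘ Θ) 0)) :
    ∃ d : LKF (async Θ 0), Bipole d (dtr (.dia A) x) [⟨_, d₁⟩] := by
  rw [dtr_dia] at mem ⊢
  refine Reaches.exists_bipole trivial mem (.ex y ?_)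
  rw [diaBody_inst]
  exact .guarded trivial rel
    (.release id (.orNeg (.falseNeg (Reaches.of_proof d₁).store_dtr)))

end Bipole

/-! ## Emulation of labeled sequent proofs -/

/-- The last hypothesis confines the free variables of `Θ` to the labels of the sequent: the
eigenvariable is dictated by the labeled proof, so its freshness there must imply freshness for `Θ`,
which also holds formulas that the labeled proof has discarded. -/
theorem LS.exists_emul {α : Type u} {G : Finset (ℕ × ℕ)} {Δ : Multiset (ℕ × Modal α)}
    (q : LS G Δ) : ∀ {Θ : Multiset (Form α 0)}, (∀ φ ∈ Δ, dtr φ.2 φ.1 ∈ Θ) →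
      (∀ e ∈ G, notR e.1 e.2 ∈ Θ) →
      (∀ F ∈ Θ, ∀ y, F.Free y → (∃ e ∈ G, y = e.1 ∨ y = e.2) ∨ ∃ φ ∈ Δ, y = φ.1) →
      ∃ d : LKF (async Θ 0), q.Emul d := by
  induction q with
  | init Δ x p =>
    intro Θ hΔ hG _
    obtain ⟨d, hd⟩ := exists_bipole_init (hΔ (x, .atom p) (by simp)) (hΔ (x, .natom p) (by simp))
    exact ⟨d, .last hd⟩
  | @and G Δ x A B q₁ q₂ ih₁ ih₂ =>
    intro Θ hΔ hG hΘ
    simp only [Multiset.mem_cons, forall_eq_or_imp, exists_eq_or_imp] at hΔ hΘ ih₁ ih₂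
    obtain ⟨d₁, h₁⟩ := ih₁ (Θ := dtr A x ::ₘ Θ) ⟨by simp, fun φ hφ => by simp [hΔ.2 φ hφ]⟩
      (fun e he => by simp [hG e he]) (by
        simp only [Multiset.mem_cons, forall_eq_or_imp]
        exact ⟨fun y hy => .inr (.inl (free_dtr hy).symm), hΘ⟩)
    obtain ⟨d₂, h₂⟩ := ih₂ (Θ := dtr B x ::ₘ Θ) ⟨by simp, fun φ hφ => by simp [hΔ.2 φ hφ]⟩
      (fun e he => by simp [hG e he]) (by
        simp only [Multiset.mem_cons, forall_eq_or_imp]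
        exact ⟨fun y hy => .inr (.inl (free_dtr hy).symm), hΘ⟩)
    obtain ⟨d, hd⟩ := exists_bipole_and hΔ.1 d₁ d₂
    exact ⟨d, d₁, d₂, .last hd, h₁, h₂⟩
  | @or G Δ x A B q₁ ih =>
    intro Θ hΔ hG hΘ
    simp only [Multiset.mem_cons, forall_eq_or_imp, exists_eq_or_imp] at hΔ hΘ ih
    obtain ⟨d₁, h₁⟩ := ih (Θ := dtr B x ::ₘ dtr A x ::ₘ Θ)
      ⟨by simp, by simp, fun φ hφ => by simp [hΔ.2 φ hφ]⟩
      (fun e he => by simp [hG e he]) (by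
        simp only [Multiset.mem_cons, forall_eq_or_imp]
        exact ⟨fun y hy => .inr (.inl (free_dtr hy).symm),
          fun y hy => .inr (.inl (free_dtr hy).symm),
          fun F hF y hy => (hΘ F hF y hy).imp_right .inr⟩)
    obtain ⟨d, hd⟩ := exists_bipole_or hΔ.1 d₁
    exact ⟨d, d₁, .last hd, h₁⟩
  | @box G Δ x y A fx fG fΔ q₁ ih =>
    intro Θ hΔ hG hΘ
    simp only [Multiset.mem_cons, forall_eq_or_imp, exists_eq_or_imp, Finset.mem_insert]
      at hΔ hΘ ih
    obtain ⟨d₁, h₁⟩ := ih (Θ := dtr A y ::ₘ notR x y ::ₘ Θ)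
      ⟨by simp, fun φ hφ => by simp [hΔ.2 φ hφ]⟩
      ⟨by simp, fun e he => by simp [hG e he]⟩ (by
        simp only [Multiset.mem_cons, forall_eq_or_imp]
        refine ⟨fun z hz => .inr (.inl (free_dtr hz).symm), fun z hz => .inl (.inl ?_),
          fun F hF z hz => ?_⟩
        · exact hz.imp (fun h => (Sum.inl.inj h).symm) fun h => (Sum.inl.inj h).symm
        · rcases hΘ F hF z hz with h | h | h
          · exact .inl (.inr h)
          -- The label `x` may have disappeared with `x : □A`, but it survives as an endpoint of the
          -- new edge.
          · exact .inl (.inl (.inl h))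
          · exact .inr (.inr h))
    obtain ⟨d, hd⟩ := exists_bipole_box (y := y) hΔ.1 (fun F hF hy => by
      rcases hΘ F hF y hy with ⟨e, he, h⟩ | h | ⟨φ, hφ, h⟩
      · exact h.elim (fG e he).1 (fG e he).2
      · exact fx h
      · exact fΔ φ hφ h) d₁
    exact ⟨d, d₁, .last hd, h₁⟩
  | @dia G Δ x y A rel q₁ ih =>
    intro Θ hΔ hG hΘ
    simp only [Multiset.mem_cons, forall_eq_or_imp, exists_eq_or_imp] at hΔ hΘ ih
    obtain ⟨d₁, h₁⟩ := ih (Θ := dtr A y ::ₘ Θ)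
      ⟨by simp [hΔ.1], by simp, fun φ hφ => by simp [hΔ.2 φ hφ]⟩
      (fun e he => by simp [hG e he]) (by
        simp only [Multiset.mem_cons, forall_eq_or_imp]
        exact ⟨fun z hz => .inr (.inr (.inl (free_dtr hz).symm)),
          fun F hF z hz => (hΘ F hF z hz).imp_right (.imp_right .inr)⟩)
    obtain ⟨d, hd⟩ := exists_bipole_dia hΔ.1 (hG _ rel) d₁
    exact ⟨d, d₁, .last hd, h₁⟩

/-! ## Emulation of prefixed tableaux -/

/-- The last hypothesis makes the prefixes on the branch a tree whose edges are stored. That parents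
are on the branch too ensures that choosing a variable for a new prefix does not disturb old edges.
The condition `σ ≠ []` exempts the root prefix, which has length one. -/
theorem PT.exists_emul {α : Type u} {b : List (Prefix × Modal α)} (q : PT b) :
    ∀ {ρ : Prefix → ℕ} {Θ : Multiset (Form α 0)}, (∀ φ ∈ b, dtr φ.2.neg (ρ φ.1) ∈ Θ) →
      (∀ φ ∈ b, φ.1 ≠ []) →
      (∀ φ ∈ b, ∀ σ n, φ.1 = σ ++ [n] → σ ≠ [] →
        (∃ ψ ∈ b, ψ.1 = σ) ∧ notR (ρ σ) (ρ (σ ++ [n])) ∈ Θ) →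
      ∃ d : LKF (async Θ 0), q.Emul ρ d := by
  induction q with
  | close σ p pos neg =>
    intro ρ Θ hb _ _
    obtain ⟨d, hd⟩ := exists_bipole_init (hb _ neg) (hb _ pos)
    exact ⟨d, .last hd⟩
  | @and b σ A B mem q₁ ih =>
    intro ρ Θ hb hne hR
    have hmem := hb _ mem
    have hmemne := hne _ mem
    have hmemR := hR _ mem
    simp only [List.mem_cons, forall_eq_or_imp, exists_eq_or_imp] at ih
    obtain ⟨d₁, h₁⟩ := ih (ρ := ρ) (Θ := dtr B.neg (ρ σ) ::ₘ dtr A.neg (ρ σ) ::ₘ Θ)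
      ⟨by simp, by simp, fun φ hφ => by simp [hb φ hφ]⟩ ⟨hmemne, hmemne, hne⟩
      ⟨fun τ n h h' => ⟨.inr (.inr (hmemR τ n h h').1), by simp [(hmemR τ n h h').2]⟩,
        fun τ n h h' => ⟨.inr (.inr (hmemR τ n h h').1), by simp [(hmemR τ n h h').2]⟩,
        fun φ hφ τ n h h' =>
          ⟨.inr (.inr (hR φ hφ τ n h h').1), by simp [(hR φ hφ τ n h h').2]⟩⟩
    obtain ⟨d, hd⟩ := exists_bipole_or hmem d₁
    exact ⟨d, d₁, .last hd, h₁⟩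
  | @or b σ A B mem q₁ q₂ ih₁ ih₂ =>
    intro ρ Θ hb hne hR
    have hmem := hb _ mem
    have hmemne := hne _ mem
    have hmemR := hR _ mem
    simp only [List.mem_cons, forall_eq_or_imp, exists_eq_or_imp] at ih₁ ih₂
    obtain ⟨d₁, h₁⟩ := ih₁ (ρ := ρ) (Θ := dtr A.neg (ρ σ) ::ₘ Θ)
      ⟨by simp, fun φ hφ => by simp [hb φ hφ]⟩ ⟨hmemne, hne⟩
      ⟨fun τ n h h' => ⟨.inr (hmemR τ n h h').1, by simp [(hmemR τ n h h').2]⟩,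
        fun φ hφ τ n h h' => ⟨.inr (hR φ hφ τ n h h').1, by simp [(hR φ hφ τ n h h').2]⟩⟩
    obtain ⟨d₂, h₂⟩ := ih₂ (ρ := ρ) (Θ := dtr B.neg (ρ σ) ::ₘ Θ)
      ⟨by simp, fun φ hφ => by simp [hb φ hφ]⟩ ⟨hmemne, hne⟩
      ⟨fun τ n h h' => ⟨.inr (hmemR τ n h h').1, by simp [(hmemR τ n h h').2]⟩,
        fun φ hφ τ n h h' => ⟨.inr (hR φ hφ τ n h h').1, by simp [(hR φ hφ τ n h h').2]⟩⟩
    obtain ⟨d, hd⟩ := exists_bipole_and hmem d₁ d₂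
    exact ⟨d, d₁, d₂, .last hd, h₁, h₂⟩
  | @box b σ n A mem used q₁ ih =>
    intro ρ Θ hb hne hR
    obtain ⟨ψ, hψ, hψn⟩ := used
    have hψR := hR ψ hψ
    simp only [List.mem_cons, forall_eq_or_imp, exists_eq_or_imp] at ih
    obtain ⟨d₁, h₁⟩ := ih (ρ := ρ) (Θ := dtr A.neg (ρ (σ ++ [n])) ::ₘ Θ)
      ⟨by simp, fun φ hφ => by simp [hb φ hφ]⟩ ⟨by simp, hne⟩
      ⟨fun τ m h h' => by
          have := hψR τ m (hψn.trans h) h'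
          exact ⟨.inr this.1, by simp [this.2]⟩,
        fun φ hφ τ n h h' => ⟨.inr (hR φ hφ τ n h h').1, by simp [(hR φ hφ τ n h h').2]⟩⟩
    obtain ⟨d, hd⟩ := exists_bipole_dia (hb _ mem) (hψR σ n hψn (hne _ mem)).2 d₁
    exact ⟨d, d₁, .last hd, h₁⟩
  | @dia b σ n A mem new q₁ ih =>
    intro ρ Θ hb hne hR
    obtain ⟨y, hy⟩ := exists_fresh Θ
    have hold : ∀ φ ∈ b, Function.update ρ (σ ++ [n]) y φ.1 = ρ φ.1 :=
      fun φ hφ => Function.update_of_ne (new φ hφ) _ _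
    simp only [List.mem_cons, forall_eq_or_imp, exists_eq_or_imp] at ih
    obtain ⟨d₁, h₁⟩ := ih (ρ := Function.update ρ (σ ++ [n]) y)
      (Θ := dtr A.neg y ::ₘ notR (ρ σ) y ::ₘ Θ)
      ⟨by simp, fun φ hφ => by simp [hold φ hφ, hb φ hφ]⟩ ⟨by simp, hne⟩
      ⟨fun τ m h _ => by
          -- The parent of the new prefix is `σ`, which carries the principal formula.
          obtain ⟨rfl, rfl⟩ : σ = τ ∧ n = m := by simpa using List.append_inj' h rfl
          exact ⟨.inr ⟨_, mem, rfl⟩, by simp⟩,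
        fun φ hφ τ m h h' => by
          obtain ⟨⟨ψ, hψ, rfl⟩, h''⟩ := hR φ hφ τ m h h'
          refine ⟨.inr ⟨ψ, hψ, rfl⟩, ?_⟩
          rw [hold ψ hψ, ← h, hold φ hφ, h]
          simp [h'']⟩
    obtain ⟨d, hd⟩ := exists_bipole_box (hb _ mem) hy d₁
    exact ⟨d, y, d₁, .last hd, h₁⟩

/-! ## Emulation of ordinary sequent proofs -/

/-- Equal multisets may be written differently; the equality in `SomeLKF` ensures that the
transported proof is still the same listed subproof. -/
theorem LKF.exists_eq_of_eq {α : Type u} {Θ Θ' Γ : Multiset (Form α 0)} (d : LKF (async Θ Γ))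
    (h : Θ = Θ') : ∃ d' : LKF (async Θ' Γ), (⟨_, d⟩ : SomeLKF α) = ⟨_, d'⟩ := by
  subst h
  exact ⟨d, rfl⟩

/-- The `◇`-bipoles of the modal rule of OS, stacked below a given proof. A sequence of bipoles is
non-empty by definition, so `l = []` needs its own alternative. -/
theorem exists_bipoles_dia {α : Type u} {x y : ℕ} {T : SomeLKF α} (l : List (Modal α)) :
    ∀ {Θ : Multiset (Form α 0)}, (∀ B ∈ l, dtr (.dia B) x ∈ Θ) → notR x y ∈ Θ →
      ∀ d₁ : LKF (async (Multiset.map (fun B => dtr B y) l + Θ) 0), T = ⟨_, d₁⟩ →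
      ∃ d : LKF (async Θ 0), (l = [] ∧ T = ⟨_, d⟩) ∨
        Bipoles d (l.map fun B => dtr (.dia B) x) [T] := by
  induction l with
  | nil =>
    rintro Θ - - d₁ rfl
    obtain ⟨d, hd⟩ := d₁.exists_eq_of_eq (Θ' := Θ) (by simp)
    exact ⟨d, .inl ⟨rfl, hd⟩⟩
  | cons B l ih =>
    rintro Θ hl rel d₁ rfl
    obtain ⟨d₂, hT⟩ := d₁.exists_eq_of_eq
      (Θ' := Multiset.map (fun B => dtr B y) (l : Multiset (Modal α)) + dtr B y ::ₘ Θ) (by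
        rw [← Multiset.cons_coe, Multiset.map_cons, Multiset.cons_add, Multiset.add_cons])
    obtain ⟨e, he⟩ := ih (Θ := dtr B y ::ₘ Θ) (fun C hC => by simp [hl C (by simp [hC])])
      (by simp [rel]) d₂ hT
    obtain ⟨d, hd⟩ := exists_bipole_dia (hl B (by simp)) rel e
    refine ⟨d, .inr ?_⟩
    rcases he with ⟨rfl, he⟩ | he
    · rw [he]
      exact .last hd
    · exact .step hd he

/-- Formulas that the modal rule discards simply stay in `Θ`, at variables that are no longer the
current world. -/
theorem OS.exists_emul {α : Type u} {Γ : Multiset (Modal α)} (q : OS Γ) :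
    ∀ {x : ℕ} {Θ : Multiset (Form α 0)}, (∀ B ∈ Γ, dtr B x ∈ Θ) →
      ∃ d : LKF (async Θ 0), q.Emul x d := by
  induction q with
  | init Γ p =>
    intro x Θ h
    obtain ⟨d, hd⟩ := exists_bipole_init (h (.atom p) (by simp)) (h (.natom p) (by simp))
    exact ⟨d, .last hd⟩
  | and A B q₁ q₂ ih₁ ih₂ =>
    intro x Θ h
    simp only [Multiset.mem_cons, forall_eq_or_imp] at h ih₁ ih₂
    obtain ⟨d₁, h₁⟩ := ih₁ (x := x) (Θ := dtr A x ::ₘ Θ) ⟨by simp, fun C hC => by simp [h.2 C hC]⟩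
    obtain ⟨d₂, h₂⟩ := ih₂ (x := x) (Θ := dtr B x ::ₘ Θ) ⟨by simp, fun C hC => by simp [h.2 C hC]⟩
    obtain ⟨d, hd⟩ := exists_bipole_and h.1 d₁ d₂
    exact ⟨d, d₁, d₂, .last hd, h₁, h₂⟩
  | or A B q₁ ih =>
    intro x Θ h
    simp only [Multiset.mem_cons, forall_eq_or_imp] at h ih
    obtain ⟨d₁, h₁⟩ := ih (x := x) (Θ := dtr B x ::ₘ dtr A x ::ₘ Θ)
      ⟨by simp, by simp, fun C hC => by simp [h.2 C hC]⟩
    obtain ⟨d, hd⟩ := exists_bipole_or h.1 d₁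
    exact ⟨d, d₁, .last hd, h₁⟩
  | box Γ Δ A q₁ ih =>
    intro x Θ h
    obtain ⟨y, hy⟩ := exists_fresh Θ
    obtain ⟨l, rfl⟩ : ∃ l : List (Modal α), (l : Multiset (Modal α)) = Γ :=
      ⟨Γ.toList, Γ.coe_toList⟩
    obtain ⟨d₁, h₁⟩ := ih (x := y) (Θ := Multiset.map (fun B => dtr B y) (l : Multiset (Modal α))
      + dtr A y ::ₘ notR x y ::ₘ Θ) (fun B hB => by
        rcases Multiset.mem_cons.1 hB with rfl | hB
        · simp
        · exact Multiset.mem_add.2 (.inl (Multiset.mem_map_of_mem _ hB)))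
    obtain ⟨e, he⟩ := exists_bipoles_dia (x := x) (y := y) l
      (Θ := dtr A y ::ₘ notR x y ::ₘ Θ)
      (fun B hB => by simp [h (.dia B) (by simp [hB])]) (by simp) d₁ rfl
    obtain ⟨d, hd⟩ := exists_bipole_box (h (.box A) (by simp)) hy e
    refine ⟨d, l, y, d₁, rfl, ?_, h₁⟩
    rcases he with ⟨rfl, he⟩ | he
    · rw [he]
      exact .last hd
    · exact .step hd he

/-! ## Emulation of nested sequent proofs -/

/-- The formulas at the node with the given path from the root, if there is such a node. -/
def Nested.formulasAt {α : Type u} : Nested α → List ℕ → Option (Multiset (Modal α))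
  | .node fs _, [] => some fs
  | .node _ bs, i :: π => bs[i]?.bind fun M => M.formulasAt π

/-- The part of the context that is at the same node as the hole. -/
def Context.inner {α : Type u} : Context α → Multiset (Modal α) × List (Nested α)
  | .here fs bs => (fs, bs)
  | .under _ _ C _ => C.inner

namespace Context

variable {α : Type u}

theorem width_eq_length (C : Context α) : C.width = C.inner.2.length := by
  induction C with
  | here => rfl
  | under _ _ _ _ ih => exact ih

/-- A context keeps its own boxed sequents in front of those of the filling, so a filling changes no
address outside it, and its first child has index `C.width`. -/
theorem formulasAt_fill_append (C : Context α) (gs : Multiset (Modal α)) (cs : List (Nested α))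
    (π : List ℕ) : (C.fill (.node gs cs)).formulasAt (C.path ++ π) =
      (Nested.node (C.inner.1 + gs) (C.inner.2 ++ cs)).formulasAt π := by
  induction C with
  | here => rfl
  | under fs left C right ih =>
    simp only [fill, path, inner, List.cons_append, Nested.formulasAt]
    rw [← ih, List.getElem?_append_right le_rfl]
    simp

theorem formulasAt_fill_of_not_prefix (C : Context α) (M N : Nested α) (π : List ℕ)
    (h : ¬ C.path <+: π) : (C.fill M).formulasAt π = (C.fill N).formulasAt π := by
  induction C generalizing π with
  | here => exact (h List.nil_prefix).elim
  | under fs left C right ih =>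
    cases π with
    | nil => rfl
    | cons i π =>
      simp only [fill, path, Nested.formulasAt] at h ⊢
      by_cases hi : i = left.length
      · subst hi
        have hp : ¬ C.path <+: π := fun hp => h (by simpa using hp)
        simpa [List.getElem?_append_right] using ih π hp
      · have : (left ++ C.fill M :: right)[i]? = (left ++ C.fill N :: right)[i]? := by
          rcases Nat.lt_or_gt_of_ne hi with hlt | hgt
          · rw [List.getElem?_append_left hlt, List.getElem?_append_left hlt]
          · rw [List.getElem?_append_right hgt.le, List.getElem?_append_right hgt.le]
            obtain ⟨k, hk⟩ := Nat.exists_eq_succ_of_ne_zero (Nat.sub_ne_zero_of_lt hgt)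
            rw [hk]
            rfl
        rw [this]

end Context

/-- The translations of all formulas of the nested sequent `M` and of its edges are in `Θ`. -/
structure Nested.Represented {α : Type u} (M : Nested α) (ρ : List ℕ → ℕ)
    (Θ : Multiset (Form α 0)) : Prop where
  formulas : ∀ π fs, M.formulasAt π = some fs → ∀ B ∈ fs, dtr B (ρ π) ∈ Θ
  edges : ∀ π i fs, M.formulasAt (π ++ [i]) = some fs → notR (ρ π) (ρ (π ++ [i])) ∈ Θ

namespace Nested.Represented

variable {α : Type u} {C : Context α} {ρ : List ℕ → ℕ} {Θ Θ' : Multiset (Form α 0)}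
  {gs gs' : Multiset (Modal α)} {cs cs' : List (Nested α)}

theorem mem (h : (C.fill (.node gs cs)).Represented ρ Θ) {B : Modal α} (hB : B ∈ gs) :
    dtr B (ρ C.path) ∈ Θ := by
  refine h.formulas C.path (C.inner.1 + gs) ?_ B (Multiset.mem_add.2 (.inr hB))
  have := C.formulasAt_fill_append gs cs []
  rwa [List.append_nil] at this

theorem mem_edge {M : Nested α} (h : (C.fill (.node gs (M :: cs))).Represented ρ Θ) :
    notR (ρ C.path) (ρ (C.path ++ [C.width])) ∈ Θ := by
  obtain ⟨fs, bs⟩ := M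
  refine h.edges C.path C.width fs ?_
  rw [C.formulasAt_fill_append, C.width_eq_length]
  simp [formulasAt]

/-- For rules that create no node: outside the hole nothing changes, so it suffices to inspect the
node of the hole and what lies below it. Since no node is new, every edge is already stored. -/
theorem replace (h : (C.fill (.node gs cs)).Represented ρ Θ) (hΘ : Θ ⊆ Θ')
    (step : ∀ π fs', (Nested.node (C.inner.1 + gs') (C.inner.2 ++ cs')).formulasAt π = some fs' →
      ∃ fs, (Nested.node (C.inner.1 + gs) (C.inner.2 ++ cs)).formulasAt π = some fs ∧
        ∀ B ∈ fs', B ∈ fs ∨ dtr B (ρ (C.path ++ π)) ∈ Θ') :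
    (C.fill (.node gs' cs')).Represented ρ Θ' := by
  have key : ∀ π fs', (C.fill (.node gs' cs')).formulasAt π = some fs' →
      ∃ fs, (C.fill (.node gs cs)).formulasAt π = some fs ∧
        ∀ B ∈ fs', B ∈ fs ∨ dtr B (ρ π) ∈ Θ' := by
    intro π fs' hπ
    by_cases hp : C.path <+: π
    · obtain ⟨π, rfl⟩ := hp
      rw [C.formulasAt_fill_append] at hπ ⊢
      exact step π fs' hπ
    · rw [C.formulasAt_fill_of_not_prefix _ (.node gs cs) π hp] at hπ
      exact ⟨fs', hπ, fun B hB => .inl hB⟩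
  refine ⟨fun π fs' hπ B hB => ?_, fun π i fs' hπ => ?_⟩
  · obtain ⟨fs, hfs, h'⟩ := key π fs' hπ
    exact (h' B hB).elim (fun hB => hΘ (h.formulas π fs hfs B hB)) id
  · obtain ⟨fs, hfs, -⟩ := key _ fs' hπ
    exact hΘ (h.edges π i fs hfs)

theorem replace_formulas (h : (C.fill (.node gs cs)).Represented ρ Θ) (hΘ : Θ ⊆ Θ')
    (new : ∀ B ∈ gs', dtr B (ρ C.path) ∈ Θ') : (C.fill (.node gs' cs)).Represented ρ Θ' := by
  refine h.replace hΘ fun π fs' hπ => ?_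
  cases π with
  | nil =>
    refine ⟨_, rfl, fun B hB => ?_⟩
    cases hπ
    rw [List.append_nil]
    exact (Multiset.mem_add.1 hB).imp (fun hB => Multiset.mem_add.2 (.inl hB)) (new B)
  | cons i π => exact ⟨fs', hπ, fun B hB => .inl hB⟩

theorem insert_child {A : Modal α} {M : Nested α}
    (h : (C.fill (.node gs (M :: cs))).Represented ρ Θ) :
    (C.fill (.node gs (M.insert A :: cs))).Represented ρ
      (dtr A (ρ (C.path ++ [C.width])) ::ₘ Θ) := by
  refine h.replace (fun F hF => Multiset.mem_cons_of_mem hF) fun π fs' hπ => ?_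
  obtain ⟨fs, bs⟩ := M
  cases π with
  | nil => exact ⟨fs', hπ, fun B hB => .inl hB⟩
  | cons i π =>
    simp only [formulasAt, insert] at hπ ⊢
    -- The active boxed sequent comes right after those of the context; at any other index nothing
    -- has changed.
    rcases lt_trichotomy i C.inner.2.length with hi | rfl | hi
    · rw [List.getElem?_append_left hi] at hπ ⊢
      exact ⟨fs', hπ, fun B hB => .inl hB⟩
    · rw [List.getElem?_append_right le_rfl] at hπ ⊢
      cases π with
      | nil =>
        simp only [Nat.sub_self, List.getElem?_cons_zero, Option.bind_some, formulasAt,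
          Option.some.injEq] at hπ ⊢
        subst hπ
        refine ⟨fs, rfl, fun B hB => ?_⟩
        rw [C.width_eq_length]
        rcases Multiset.mem_cons.1 hB with rfl | hB
        · exact .inr (Multiset.mem_cons_self _ _)
        · exact .inl hB
      | cons j π =>
        exact ⟨fs', by simpa [formulasAt] using hπ, fun B hB => .inl hB⟩
    · rw [List.getElem?_append_right hi.le] at hπ ⊢
      obtain ⟨k, hk⟩ := Nat.exists_eq_succ_of_ne_zero (Nat.sub_ne_zero_of_lt hi)
      rw [hk] at hπ ⊢
      exact ⟨fs', hπ, fun B hB => .inl hB⟩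

/-- The address of the new child was unoccupied, so assigning `y` to it leaves the variables of all
existing nodes unchanged. -/
theorem new_child {A : Modal α} {y : ℕ} (h : (C.fill (.node gs [])).Represented ρ Θ) :
    (C.fill (.node 0 [.single A])).Represented (Function.update ρ (C.path ++ [C.width]) y)
      (dtr A y ::ₘ notR (ρ C.path) y ::ₘ Θ) := by
  have none_at : ∀ π, (C.fill (.node gs [])).formulasAt (C.path ++ C.width :: π) = none := by
    intro π
    rw [C.formulasAt_fill_append, C.width_eq_length]
    simp [formulasAt]
  have key : ∀ π fs', (C.fill (.node 0 [.single A])).formulasAt π = some fs' →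
      (π = C.path ++ [C.width] ∧ fs' = {A}) ∨
        ∃ fs, (C.fill (.node gs [])).formulasAt π = some fs ∧ fs' ⊆ fs := by
    intro π fs' hπ
    by_cases hp : C.path <+: π
    · obtain ⟨π, rfl⟩ := hp
      rw [C.formulasAt_fill_append] at hπ ⊢
      rw [C.width_eq_length]
      cases π with
      | nil =>
        cases hπ
        refine .inr ⟨_, rfl, fun B hB => ?_⟩
        rw [add_zero] at hB
        exact Multiset.mem_add.2 (.inl hB)
      | cons i π =>
        simp only [formulasAt, Nested.single] at hπ ⊢
        rcases lt_trichotomy i C.inner.2.length with hi | rfl | hi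
        · rw [List.getElem?_append_left hi] at hπ ⊢
          exact .inr ⟨fs', hπ, fun B hB => hB⟩
        · rw [List.getElem?_append_right le_rfl] at hπ
          cases π with
          | nil => exact .inl ⟨rfl, by simpa [formulasAt, eq_comm] using hπ⟩
          | cons j π => simp [formulasAt] at hπ
        · rw [List.getElem?_append_right hi.le] at hπ
          obtain ⟨k, hk⟩ := Nat.exists_eq_succ_of_ne_zero (Nat.sub_ne_zero_of_lt hi)
          simp [hk] at hπ
    · rw [C.formulasAt_fill_of_not_prefix _ (.node gs []) π hp] at hπ
      exact .inr ⟨fs', hπ, fun B hB => hB⟩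
  -- Stated for prefixes of occupied addresses, so that it also covers the parent node of an edge.
  have update_of_some : ∀ π π' fs, (C.fill (.node gs [])).formulasAt (π ++ π') = some fs →
      Function.update ρ (C.path ++ [C.width]) y π = ρ π := by
    intro π π' fs hπ
    refine Function.update_of_ne ?_ _ _
    rintro rfl
    rw [List.append_assoc, List.singleton_append, none_at] at hπ
    cases hπ
  refine ⟨fun π fs' hπ B hB => ?_, fun π i fs' hπ => ?_⟩
  · rcases key π fs' hπ with ⟨rfl, rfl⟩ | ⟨fs, hfs, hsub⟩
    · rw [Multiset.mem_singleton.1 hB, Function.update_self]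
      exact Multiset.mem_cons_self _ _
    · rw [update_of_some π [] fs (by rwa [List.append_nil])]
      simp [h.formulas π fs hfs B (hsub hB)]
  · rcases key _ fs' hπ with ⟨he, -⟩ | ⟨fs, hfs, -⟩
    · obtain ⟨rfl, hi⟩ := List.append_inj' he rfl
      rw [he, Function.update_self, Function.update_of_ne (by simp)]
      simp
    · rw [update_of_some π [i] fs hfs, update_of_some _ [] fs (by rwa [List.append_nil])]
      simp [h.edges π i fs hfs]

end Nested.Represented

theorem NS.exists_emul {α : Type u} {M : Nested α} (q : NS M) :
    ∀ {ρ : List ℕ → ℕ} {Θ : Multiset (Form α 0)}, M.Represented ρ Θ →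
      ∃ d : LKF (async Θ 0), q.Emul ρ d := by
  have sub : ∀ {F : Form α 0} {Θ : Multiset (Form α 0)}, Θ ⊆ F ::ₘ Θ :=
    fun {_ _} _ h => Multiset.mem_cons_of_mem h
  induction q with
  | init C p =>
    intro ρ Θ h
    obtain ⟨d, hd⟩ := exists_bipole_init (h.mem (B := .atom p) (by simp))
      (h.mem (B := .natom p) (by simp))
    exact ⟨d, .last hd⟩
  | and C A B q₁ q₂ ih₁ ih₂ =>
    intro ρ Θ h
    obtain ⟨d₁, h₁⟩ := ih₁ (h.replace_formulas (Θ' := dtr A (ρ C.path) ::ₘ Θ) sub (by simp))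
    obtain ⟨d₂, h₂⟩ := ih₂ (h.replace_formulas (Θ' := dtr B (ρ C.path) ::ₘ Θ) sub (by simp))
    obtain ⟨d, hd⟩ := exists_bipole_and (h.mem (Multiset.mem_singleton_self _)) d₁ d₂
    exact ⟨d, d₁, d₂, .last hd, h₁, h₂⟩
  | or C A B q₁ ih =>
    intro ρ Θ h
    obtain ⟨d₁, h₁⟩ := ih (h.replace_formulas
      (Θ' := dtr B (ρ C.path) ::ₘ dtr A (ρ C.path) ::ₘ Θ) (fun _ hF => sub (sub hF)) (by simp))
    obtain ⟨d, hd⟩ := exists_bipole_or (h.mem (Multiset.mem_singleton_self _)) d₁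
    exact ⟨d, d₁, .last hd, h₁⟩
  | box C A q₁ ih =>
    intro ρ Θ h
    obtain ⟨y, hy⟩ := exists_fresh Θ
    obtain ⟨d₁, h₁⟩ := ih (h.new_child (y := y))
    obtain ⟨d, hd⟩ := exists_bipole_box (h.mem (Multiset.mem_singleton_self _)) hy d₁
    exact ⟨d, y, d₁, .last hd, h₁⟩
  | dia C A M N q₁ ih =>
    intro ρ Θ h
    obtain ⟨d₁, h₁⟩ := ih h.insert_child
    obtain ⟨d, hd⟩ := exists_bipole_dia (h.mem (Multiset.mem_singleton_self _)) h.mem_edge d₁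
    exact ⟨d, d₁, .last hd, h₁⟩

theorem Nested.single_represented {α : Type u} (A : Modal α) (x : ℕ) :
    (Nested.single A).Represented (fun _ => x) {dtr A x} := by
  refine ⟨fun π fs h B hB => ?_, fun π i fs h => ?_⟩
  · cases π with
    | nil =>
      cases h
      rw [Multiset.mem_singleton.1 hB]
      exact Multiset.mem_singleton_self _
    | cons i π => simp [single, formulasAt] at h
  · cases π <;> simp [single, formulasAt] at h

/-! ## The four systems and LKF -/

theorem Modal.neg_neg {α : Type u} (A : Modal α) : A.neg.neg = A := by
  induction A <;> simp_all only [Modal.neg]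

theorem Calculus.exists_emulates {α : Type u} (X : Calculus) {A : Modal α} {x : ℕ}
    (q : X.Proof A x) : ∃ d : LKF (async {dtr A x} 0), X.Emulates q d := by
  cases X with
  | LS =>
    refine LS.exists_emul q (by simp) (by simp) fun F hF y hy => .inr ⟨(x, A), by simp, ?_⟩
    rw [Multiset.mem_singleton.1 hF] at hy
    exact (free_dtr hy).symm
  | PT =>
    refine PT.exists_emul q (by simp [Modal.neg_neg]) (by simp) fun φ hφ σ n h hσ => ?_
    rw [List.mem_singleton.1 hφ] at h
    cases σ with
    | nil => exact (hσ rfl).elim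
    | cons k σ => simp at h
  | OS => exact OS.exists_emul q (by simp)
  | NS => exact NS.exists_emul q (Nested.single_represented A x)

/-! ### LKF proofs of valid formulas -/

theorem nonempty_LKF_of_valid {α : Type u} {Γ : Multiset (Modal α)}
    (valid : ∀ t, ∃ B ∈ Γ, B.Sat t) {x : ℕ} {Θ : Multiset (Form α 0)}
    (h : ∀ B ∈ Γ, dtr B x ∈ Θ) : Nonempty (LKF (async Θ 0)) :=
  (OS.complete Γ valid).elim fun q => (q.exists_emul h).elim fun d _ => ⟨d⟩

/-- Any tree can be hung below a new root; the valuation there is irrelevant. -/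
theorem Modal.valid_of_box {α : Type u} {A : Modal α} (valid : ∀ t, (Modal.box A).Sat t)
    (t : Tree α) : A.Sat t :=
  valid (.node (fun _ => True) [t]) t List.mem_cons_self

/-- An undelayed negative formula cannot be stored unless it is a literal, so its top connective is
decomposed first. Validity passes to the resulting premise or premises, whose formulas are delayed
and can be stored. -/
theorem nonempty_LKF_tr_of_valid {α : Type u} {A : Modal α} (valid : ∀ t, A.Sat t) (x : ℕ) :
    Nonempty (LKF (async 0 {tr A x})) := by
  have stored : ∀ {A : Modal α}, (∀ t, A.Sat t) → ∀ {x : ℕ} {Θ : Multiset (Form α 0)},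
      dtr A x ∈ Θ → Nonempty (LKF (async Θ 0)) := fun {A} valid {_ _} h =>
    nonempty_LKF_of_valid (Γ := {A}) (fun t => ⟨A, by simp, valid t⟩) (by simpa using h)
  have undelayed : ((tr A x).Pos ∨ (tr A x).NegLit) → Nonempty (LKF (async 0 {tr A x})) := by
    intro h
    obtain ⟨d⟩ := stored valid (x := x) (Θ := {tr A x}) (by simp [dtr, Form.delay, h])
    exact ⟨.store _ h d⟩
  cases A with
  | atom p => exact undelayed (.inl (by simp [tr, trans, Form.Pos]))
  | natom p => exact undelayed (.inr (by simp [tr, trans, Form.NegLit]))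
  | dia A => exact undelayed (.inl (by simp [tr, trans, Form.Pos]))
  | and A B =>
    obtain ⟨d₁⟩ := stored (fun t => (valid t).1) (x := x) (Multiset.mem_singleton_self (dtr A x))
    obtain ⟨d₂⟩ := stored (fun t => (valid t).2) (x := x) (Multiset.mem_singleton_self (dtr B x))
    exact ⟨.andNeg (dtr A x) (dtr B x) (.store _ (Form.delay_store _) d₁)
      (.store _ (Form.delay_store _) d₂)⟩
  | or A B =>
    obtain ⟨d⟩ := nonempty_LKF_of_valid (Γ := {A, B}) (x := x) (Θ := {dtr B x, dtr A x})
      (fun t => by simpa [Modal.Sat] using valid t) (by simp)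
    exact ⟨.orNeg (dtr A x) (dtr B x) (.store _ (Form.delay_store _)
      (.store _ (Form.delay_store _) d))⟩
  | box A =>
    obtain ⟨y, hy⟩ := exists_fresh {dtr (.box A) x}
    obtain ⟨d⟩ := stored (Modal.valid_of_box valid)
      (Multiset.mem_cons_self (dtr A y) (notR x y ::ₘ 0))
    obtain ⟨e, -⟩ := Reaches.box (by simp) (hy _ (Multiset.mem_singleton_self _)) (.of_proof d)
    exact ⟨e⟩

theorem Calculus.nonempty_LKF_dtr {α : Type u} {X : Calculus} {A : Modal α}
    (h : X.Provable A) (x : ℕ) : Nonempty (LKF (async {dtr A x} 0)) :=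
  (h x).elim fun q => (X.exists_emulates q).elim fun d _ => ⟨d⟩

/-- Soundness of all four systems at once, by way of LKF; the variable 0 is an arbitrary choice. -/
theorem Calculus.valid_of_provable {α : Type u} {X : Calculus} {A : Modal α}
    (h : X.Provable A) (t : Tree α) : A.Sat t :=
  (nonempty_LKF_dtr h 0).elim fun d => sat_of_LKF_dtr d t

end ModalCert

theorem theorem2 {α : Type*} (X : ModalCert.Calculus) (A : ModalCert.Modal α) (x : ℕ) :
    (X.Provable A ↔ Nonempty (ModalCert.LKF (.async 0 {ModalCert.tr A x}))) ∧
    (X.Provable A ↔ Nonempty (ModalCert.LKF (.async {ModalCert.dtr A x} 0))) ∧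
    ∀ p : X.Proof A x, ∃ p' : ModalCert.LKF (.async {ModalCert.dtr A x} 0), X.Emulates p p' :=
  ⟨⟨fun h => ModalCert.nonempty_LKF_tr_of_valid (ModalCert.Calculus.valid_of_provable h) x,
      fun ⟨d⟩ => X.provable_of_valid (ModalCert.sat_of_LKF_tr d)⟩,
    ⟨fun h => ModalCert.Calculus.nonempty_LKF_dtr h x,
      fun ⟨d⟩ => X.provable_of_valid (ModalCert.sat_of_LKF_dtr d)⟩,
    fun p => X.exists_emulates p⟩
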